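/- **Setting.** Let $1\le d\le 3$, let $\Omega\subset\mathbb R^d$ be a bounded, connected open set with smooth boundary, $T>0$, $Q=\Omega\times(0,T)$, $H=L^2(\Omega)$, $V=H^1(\Omega)$, $W=\{v\in H^2(\Omega):\partial_\nu v=0\}$, and let $V^*$ be the dual of $V$ (with $V\subset H\subset V^*$ as usual). Let $\hat\beta:\mathbb R\to[0,+\infty]$ be convex and lower semicontinuous with $\hat\beta(0)=0$, let $\hat\pi:\mathbb R\to\mathbb R$ be of class $C^1$ with Lipschitz continuous derivative, and set $\beta=\partial\hat\beta$ (subdifferential, with domain $D(\beta)=\{r:\beta(r)\neq\emptyset\}$) and $\pi=\hat\pi'$. Let $M\ge 0$, $u\in L^\infty(Q)$ with $\|u\|_\infty\le M$, and let $\varphi_0\in W$ be such that $\inf\varphi_0$, $\sup\varphi_0$ and $|\Omega|^{-1}\int_\Omega\varphi_0\pm M$ belong to the interior of $D(\beta)$. A *solution* is a triplet $(\varphi,\mu,\xi)$ with $\varphi\in H^1(0,T;V^*)\cap L^\infty(0,T;V)$, $\mu\in L^2(0,T;V)$, $\xi\in L^2(0,T;H)$, $\xi\in\beta(\varphi)$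 a.e. in $Q$, $\varphi(0)=\varphi_0$ a.e. in $\Omega$ and, for a.a. $t\in(0,T)$ and every $v\in V$, $$\langle\partial_t\varphi(t),v\rangle+\int_\Omega\varphi(t)\,v+\int_\Omega\nabla\mu(t)\cdot\nabla v=\int_\Omega u(t)\,v,$$ $$\int_\Omega\mu(t)\,v=\int_\Omega\nabla\varphi(t)\cdot\nabla v+\int_\Omega\xi(t)\,v+\int_\Omega\pi(\varphi(t))\,v .$$ **Proposition 2.5.** (i) Let $(\varphi,\mu,\xi)$ be a solution. If $\varphi,\mu\in L^\infty(Q)$, then $\xi\in L^\infty(Q)$ and $$\|\xi\|_{L^\infty(Q)}\le\|\varphi+\mu-\pi(\varphi)\|_{L^\infty(Q)} .$$ (ii) Suppose that $D(\beta)$ is a bounded open interval. Then for every $K$ there is a compact interval $[a,b]\subset D(\beta)$, depending only on $\beta$ and $K$ (and not on $d$, $\Omega$, $T$, $\hat\pi$, $u$, $M$, $\varphi_0$ or the solution), such that every solution $(\varphi,\mu,\xi)$ with $\|\xi\|_{L^\infty(Q)}\le K$ satisfies $\varphi\in[a,b]$ a.e. in $Q$. -/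

import Mathlib

open MeasureTheory Set Filter Topology
open scoped ENNReal NNReal ContDiff

noncomputable section

namespace CahnHilliardOono

/-! ### Domains and Sobolev spaces -/

/-- The Euclidean space `ℝ^d`. -/
abbrev Space (d : ℕ) := EuclideanSpace ℝ (Fin d)

/-- `Ω ⊂ ℝ^d` is a bounded, connected, nonempty open set with `C^∞` boundary: near each boundary
point, `Ω` is the strict sublevel set `{ρ < 0}` of a smooth function `ρ` whose differential does not
vanish (so that, there, `∂Ω` is the hypersurface `{ρ = 0}` and `Ω` lies on one side of it). -/
structure IsSmoothDomain {d : ℕ} (Ω : Set (Space d)) : Prop where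
  isOpen : IsOpen Ω
  isBounded : Bornology.IsBounded Ω
  isConnected : IsConnected Ω
  smooth_boundary : ∀ x₀ ∈ frontier Ω, ∃ U : Set (Space d), IsOpen U ∧ x₀ ∈ U ∧
    ∃ ρ : Space d → ℝ, ContDiffOn ℝ ∞ ρ U ∧ (∀ x ∈ U, fderiv ℝ ρ x ≠ 0) ∧
      ∀ x ∈ U, (x ∈ Ω ↔ ρ x < 0)

/-- Test functions `C_c^∞(U)`. -/
structure IsTestFunction {X : Type*} [NormedAddCommGroup X] [NormedSpace ℝ X]
    (U : Set X) (ψ : X → ℝ) : Prop where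
  contDiff : ContDiff ℝ ∞ ψ
  hasCompactSupport : HasCompactSupport ψ
  tsupport_subset : tsupport ψ ⊆ U

/-- `G` is the weak (distributional) gradient of `v` on `Ω`:
`∫_Ω v ∂ᵢψ = - ∫_Ω Gᵢ ψ` for all test functions `ψ` on `Ω` and all `i`. -/
def IsWeakGradient {d : ℕ} (Ω : Set (Space d)) (v : Space d → ℝ) (G : Space d → Space d) : Prop :=
  ∀ ψ : Space d → ℝ, IsTestFunction Ω ψ → ∀ i : Fin d,
    ∫ x in Ω, v x * fderiv ℝ ψ x (EuclideanSpace.single i 1) = - ∫ x in Ω, G x i * ψ x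

/-- `H = L²(Ω)`. -/
abbrev L2 {d : ℕ} (Ω : Set (Space d)) := Lp ℝ 2 (volume.restrict Ω)

lemma IsTestFunction.memLp {d : ℕ} {Ω : Set (Space d)} {ψ : Space d → ℝ}
    (h : IsTestFunction Ω ψ) : MemLp ψ 2 (volume.restrict Ω) :=
  h.contDiff.continuous.memLp_of_hasCompactSupport h.hasCompactSupport

lemma IsTestFunction.memLp_fderiv {d : ℕ} {Ω : Set (Space d)} {ψ : Space d → ℝ}
    (h : IsTestFunction Ω ψ) (e : Space d) :
    MemLp (fun x => fderiv ℝ ψ x e) 2 (volume.restrict Ω) :=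
  ((h.contDiff.continuous_fderiv (by simp)).clm_apply
    continuous_const).memLp_of_hasCompactSupport (h.hasCompactSupport.fderiv_apply ℝ e)

lemma memLp_coord {d : ℕ} {Ω : Set (Space d)} {G : Space d → Space d}
    (hG : MemLp G 2 (volume.restrict Ω)) (i : Fin d) :
    MemLp (fun x => G x i) 2 (volume.restrict Ω) :=
  (EuclideanSpace.proj i : Space d →L[ℝ] ℝ).comp_memLp' hG

lemma IsWeakGradient.congr {d : ℕ} {Ω : Set (Space d)} {v w : Space d → ℝ}
    {G K : Space d → Space d} (h : IsWeakGradient Ω v G)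
    (hv : v =ᵐ[volume.restrict Ω] w) (hG : G =ᵐ[volume.restrict Ω] K) :
    IsWeakGradient Ω w K := by
  intro ψ hψ i
  have h1 : ∫ x in Ω, w x * fderiv ℝ ψ x (EuclideanSpace.single i 1)
      = ∫ x in Ω, v x * fderiv ℝ ψ x (EuclideanSpace.single i 1) :=
    integral_congr_ae (by filter_upwards [hv] with x hx; rw [hx])
  have h2 : ∫ x in Ω, K x i * ψ x = ∫ x in Ω, G x i * ψ x :=
    integral_congr_ae (by filter_upwards [hG] with x hx; rw [hx])
  rw [h1, h2]
  exact h ψ hψ i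

/-- The subspace of the pairs `(v, ∇v)` in `L²(Ω) × L²(Ω)^d`, with the Hilbert norm
`(‖v‖² + ‖∇v‖²)^{1/2}`. -/
def h1Submodule {d : ℕ} (Ω : Set (Space d)) :
    Submodule ℝ (WithLp 2 (L2 Ω × Lp (Space d) 2 (volume.restrict Ω))) where
  carrier := {p | IsWeakGradient Ω p.fst p.snd}
  zero_mem' := by
    have h : IsWeakGradient Ω (0 : Space d → ℝ) (0 : Space d → Space d) := by
      intro ψ hψ i
      simp
    exact h.congr (Lp.coeFn_zero ℝ 2 _).symm (Lp.coeFn_zero (Space d) 2 _).symm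
  add_mem' := by
    intro p q hp hq
    have h : IsWeakGradient Ω (p.fst + q.fst : Space d → ℝ) (p.snd + q.snd : Space d → Space d) := by
      intro ψ hψ i
      have e := hψ.memLp_fderiv (EuclideanSpace.single i 1)
      have h1 := integral_add ((Lp.memLp p.fst).integrable_mul e)
        ((Lp.memLp q.fst).integrable_mul e)
      have h2 := integral_add ((memLp_coord (Lp.memLp p.snd) i).integrable_mul hψ.memLp)
        ((memLp_coord (Lp.memLp q.snd) i).integrable_mul hψ.memLp)
      simp only [Pi.mul_apply] at h1 h2
      simp only [Pi.add_apply, PiLp.add_apply, add_mul]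
      rw [h1, h2, hp ψ hψ i, hq ψ hψ i]
      ring
    exact h.congr (Lp.coeFn_add _ _).symm (Lp.coeFn_add _ _).symm
  smul_mem' := by
    intro c p hp
    have h : IsWeakGradient Ω (c • (p.fst : Space d → ℝ)) (c • (p.snd : Space d → Space d)) := by
      intro ψ hψ i
      simp only [Pi.smul_apply, PiLp.smul_apply, smul_eq_mul, mul_assoc]
      rw [integral_const_mul, integral_const_mul, hp ψ hψ i]
      ring
    exact h.congr (Lp.coeFn_smul _ _).symm (Lp.coeFn_smul _ _).symm

/-- `V = H¹(Ω)`, realized as the space of the pairs `(v, ∇v) ∈ L²(Ω) × L²(Ω)^d`, with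
`‖v‖_V² = ‖v‖² + ‖∇v‖²`. -/
def H1 {d : ℕ} (Ω : Set (Space d)) : Type := h1Submodule Ω

instance {d : ℕ} (Ω : Set (Space d)) : NormedAddCommGroup (H1 Ω) :=
  inferInstanceAs (NormedAddCommGroup (h1Submodule Ω))

instance {d : ℕ} (Ω : Set (Space d)) : InnerProductSpace ℝ (H1 Ω) :=
  inferInstanceAs (InnerProductSpace ℝ (h1Submodule Ω))

/-- The function `v` underlying an element of `H¹(Ω)`, as an element of `L²(Ω)`. -/
def H1.toL2 {d : ℕ} {Ω : Set (Space d)} : H1 Ω →L[ℝ] L2 Ω :=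
  (WithLp.fstL 2 ℝ (L2 Ω) (Lp (Space d) 2 (volume.restrict Ω))).comp (h1Submodule Ω).subtypeL

/-- The function underlying an element of `H¹(Ω)`. -/
def H1.val {d : ℕ} {Ω : Set (Space d)} (v : H1 Ω) : Space d → ℝ := H1.toL2 v

/-- The weak gradient of an element of `H¹(Ω)`. -/
def H1.grad {d : ℕ} {Ω : Set (Space d)} (v : H1 Ω) : Space d → Space d :=
  (Subtype.val (p := (· ∈ h1Submodule Ω)) v).snd

/-- The dual space `V*` of `V = H¹(Ω)`. -/
abbrev H1Dual {d : ℕ} (Ω : Set (Space d)) := StrongDual ℝ (H1 Ω)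

/-- The embedding `V ⊂ H ⊂ V*` of the Hilbert triplet: `⟨v, w⟩ = ∫_Ω v w`. -/
def H1.toDual {d : ℕ} {Ω : Set (Space d)} (v : H1 Ω) : H1Dual Ω :=
  (innerSL ℝ (H1.toL2 v)).comp H1.toL2

/-- The function `v` belongs to `W = {v ∈ H²(Ω) : ∂_ν v = 0}`: `v` and all its first weak
derivatives `∂ᵢ v` belong to `H¹(Ω)`, and the normal trace of `∇v` vanishes on the boundary in the
sense of Green's formula, `∫_Ω ∇v · ∇w + ∫_Ω Δv w = 0` for every `w ∈ H¹(Ω)`. -/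
def MemW {d : ℕ} (Ω : Set (Space d)) (v : Space d → ℝ) : Prop :=
  ∃ (z : H1 Ω) (D : Fin d → H1 Ω),
    v =ᵐ[volume.restrict Ω] H1.val z ∧
    (∀ i, (fun x => H1.grad z x i) =ᵐ[volume.restrict Ω] H1.val (D i)) ∧
    ∀ w : H1 Ω, (∫ x in Ω, inner ℝ (H1.grad z x) (H1.grad w x))
      + (∫ x in Ω, (∑ i, H1.grad (D i) x i) * H1.val w x) = 0

/-! ### The nonlinearities -/

/-- The subdifferential of `βhat : ℝ → [0, +∞]` at `r`: the set of all real `s` such that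
`βhat r + s (q - r) ≤ βhat q` for every `q`, where `βhat r` has to be finite. -/
def subdiff (βhat : ℝ → ℝ≥0∞) (r : ℝ) : Set ℝ :=
  {s | βhat r ≠ ⊤ ∧
    ∀ q : ℝ, (βhat r : EReal) + ((s * (q - r) : ℝ) : EReal) ≤ (βhat q : EReal)}

/-- The domain `D(β)` of `β = ∂βhat`. -/
def subdiffDomain (βhat : ℝ → ℝ≥0∞) : Set ℝ := {r | (subdiff βhat r).Nonempty}

/-- The assumptions on the convex part `βhat` of the potential: `βhat : ℝ → [0, +∞]` is convex,
lower semicontinuous, and `βhat 0 = 0` (so that it is proper). -/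
structure IsConvexPart (βhat : ℝ → ℝ≥0∞) : Prop where
  convex : ConvexOn ℝ≥0 univ βhat
  lsc : LowerSemicontinuous βhat
  map_zero : βhat 0 = 0

/-- The assumptions on the smooth perturbation `πhat`: it is of class `C¹` and its derivative `π`
is Lipschitz continuous. -/
structure IsSmoothPart (πhat : ℝ → ℝ) : Prop where
  contDiff : ContDiff ℝ 1 πhat
  lipschitz : ∃ L : ℝ≥0, LipschitzWith L (deriv πhat)

/-! ### The space-time cylinder, the data and the solutions -/

/-- Lebesgue measure on `(0, T)`. -/
abbrev timeMeasure (T : ℝ) : Measure ℝ := volume.restrict (Ioo 0 T)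

/-- Lebesgue measure on the cylinder `Q = Ω × (0, T)`. -/
abbrev cylMeasure {d : ℕ} (Ω : Set (Space d)) (T : ℝ) : Measure (Space d × ℝ) :=
  volume.restrict (Ω ×ˢ Ioo 0 T)

/-- The assumptions on the domain, the final time, `πhat` and the data (those on `βhat` are in
`IsConvexPart`; the potential is `f = βhat + πhat`):
`1 ≤ d ≤ 3`, `Ω` is a bounded connected smooth domain, `T > 0`, `πhat` is smooth as above,
`u ∈ L^∞(Q)` with `‖u‖_∞ ≤ M`, `φ₀ ∈ W` with `inf φ₀` and `sup φ₀` in the interior of `D(β)`, and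
`mean(φ₀) ± M` in the interior of `D(β)`. -/
structure Assumptions {d : ℕ} (Ω : Set (Space d)) (T : ℝ) (βhat : ℝ → ℝ≥0∞) (πhat : ℝ → ℝ)
    (u : Space d × ℝ → ℝ) (M : ℝ) (φ₀ : Space d → ℝ) : Prop where
  one_le_dim : 1 ≤ d
  dim_le_three : d ≤ 3
  domain : IsSmoothDomain Ω
  time_pos : 0 < T
  smoothPart : IsSmoothPart πhat
  u_memLp : MemLp u ⊤ (cylMeasure Ω T)
  M_nonneg : 0 ≤ M
  u_le : eLpNorm u ⊤ (cylMeasure Ω T) ≤ ENNReal.ofReal M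
  φ₀_mem : MemW Ω φ₀
  inf_mem : essInf φ₀ (volume.restrict Ω) ∈ interior (subdiffDomain βhat)
  sup_mem : essSup φ₀ (volume.restrict Ω) ∈ interior (subdiffDomain βhat)
  mean_add_mem : (⨍ x in Ω, φ₀ x) + M ∈ interior (subdiffDomain βhat)
  mean_sub_mem : (⨍ x in Ω, φ₀ x) - M ∈ interior (subdiffDomain βhat)

/-- The function `w` on `Q` is a (jointly measurable) representative of the time-dependent function
`t ↦ W t`, where `W t` is the function `w(·, t)` on `Ω`. -/
def Represents {d : ℕ} (Ω : Set (Space d)) (T : ℝ) (w : Space d × ℝ → ℝ)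
    (W : ℝ → Space d → ℝ) : Prop :=
  AEStronglyMeasurable w (cylMeasure Ω T) ∧
    ∀ᵐ t ∂timeMeasure T, (fun x => w (x, t)) =ᵐ[volume.restrict Ω] W t

/-- `Φ'` is the weak derivative on `(0, T)` of the `V`-valued function `Φ`, as a `V*`-valued
function: `∫ η' Φ = - ∫ η Φ'` in `V*`, for all test functions `η` on `(0, T)`. -/
def IsWeakTimeDeriv {d : ℕ} {Ω : Set (Space d)} (T : ℝ) (Φ : ℝ → H1 Ω) (Φ' : ℝ → H1Dual Ω) :
    Prop :=
  ∀ η : ℝ → ℝ, IsTestFunction (Ioo 0 T) η →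
    ∫ t in Ioo 0 T, deriv η t • H1.toDual (Φ t) = - ∫ t in Ioo 0 T, η t • Φ' t

/-- The initial condition: the representative of `Φ` in `C⁰([0, T]; H)` takes the value `φ₀` at
time `0`. -/
def HasInitialValue {d : ℕ} {Ω : Set (Space d)} (T : ℝ) (Φ : ℝ → H1 Ω) (φ₀ : Space d → ℝ) :
    Prop :=
  ∃ Φc : ℝ → L2 Ω, ContinuousOn Φc (Icc 0 T) ∧
    (∀ᵐ t ∂timeMeasure T, Φc t = H1.toL2 (Φ t)) ∧ Φc 0 =ᵐ[volume.restrict Ω] φ₀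

/-- `(φ, μ, ξ)` is a (weak) solution, with `β = ∂βhat` and `π = πhat'`:
* `φ ∈ H¹(0,T;V*) ∩ L^∞(0,T;V)` (with time derivative `dφ`), `μ ∈ L²(0,T;V)`, `ξ ∈ L²(0,T;H)`;
* `ξ ∈ β(φ)` a.e. in `Q`;
* for a.a. `t ∈ (0,T)` and all `v ∈ V`,
  `⟨∂ₜφ(t), v⟩ + ∫ φ(t) v + ∫ ∇μ(t) · ∇v = ∫ u(t) v`, and
  `∫ μ(t) v = ∫ ∇φ(t) · ∇v + ∫ ξ(t) v + ∫ π(φ(t)) v`;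
* `φ(0) = φ₀`. -/
def IsSolution {d : ℕ} (Ω : Set (Space d)) (T : ℝ) (βhat : ℝ → ℝ≥0∞) (πhat : ℝ → ℝ)
    (u : Space d × ℝ → ℝ) (φ₀ : Space d → ℝ) (φ μ ξ : Space d × ℝ → ℝ) : Prop :=
  ∃ (Φ : ℝ → H1 Ω) (dφ : ℝ → H1Dual Ω) (N : ℝ → H1 Ω) (Ξ : ℝ → L2 Ω),
    Represents Ω T φ (fun t => H1.val (Φ t)) ∧
    Represents Ω T μ (fun t => H1.val (N t)) ∧
    Represents Ω T ξ (fun t => Ξ t) ∧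
    MemLp Φ ⊤ (timeMeasure T) ∧
    MemLp dφ 2 (timeMeasure T) ∧
    IsWeakTimeDeriv T Φ dφ ∧
    MemLp N 2 (timeMeasure T) ∧
    MemLp Ξ 2 (timeMeasure T) ∧
    (∀ᵐ p ∂cylMeasure Ω T, ξ p ∈ subdiff βhat (φ p)) ∧
    (∀ᵐ t ∂timeMeasure T, ∀ v : H1 Ω,
      dφ t v + (∫ x in Ω, φ (x, t) * H1.val v x)
        + (∫ x in Ω, inner ℝ (H1.grad (N t) x) (H1.grad v x))
      = ∫ x in Ω, u (x, t) * H1.val v x) ∧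
    (∀ᵐ t ∂timeMeasure T, ∀ v : H1 Ω,
      ∫ x in Ω, μ (x, t) * H1.val v x
      = (∫ x in Ω, inner ℝ (H1.grad (Φ t) x) (H1.grad v x))
        + (∫ x in Ω, ξ (x, t) * H1.val v x)
        + (∫ x in Ω, deriv πhat (φ (x, t)) * H1.val v x)) ∧
    HasInitialValue T Φ φ₀

end CahnHilliardOono

end

open CahnHilliardOono

/-!
At almost every time the second equation is the elliptic inclusion `φ - Δφ + ξ = g`, `ξ ∈ β(φ)`,
with homogeneous Neumann condition and `g = φ + μ - π(φ)`. Since `β` is monotone and `0 ∈ β(0)`, the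
bound `‖ξ‖_∞ ≤ C := ‖g‖_∞` is a maximum principle. By symmetry it suffices to show `ξ ≤ C`. Let
`c ≥ 0` be the infimum of the points at which `β` takes a value above `C`. Where `φ > c`, one has
`ξ > C ≥ g`, hence `-Δφ < 0`; testing with a nondecreasing function of `φ` that vanishes for `φ ≤ c`
gives `φ ≤ c` (`ae_le_of_forall_lt_neg`).

If `β` is multivalued at `c`, it remains to bound `ξ` on the contact set `{φ = c}`. There
`-Δφ ≥ 0`, that is `ξ ≤ g - φ ≤ C`. This needs neither the `H²` regularity of `φ` nor the vanishing
of `∇φ` on level sets: it suffices to test with `hₙ(φ) ζ`, where `hₙ` approximates the indicator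
function of `{c}` and `ζ ≥ 0` is a test function on `Ω` (`ae_nonneg_of_eq_of_ae_le`). Slicing the
cylinder turns the bound at almost every time into a bound on `Q`.

These tests rest on the chain rule in `H¹(Ω)` for `C¹` functions that are bounded with bounded
derivative (`IsWeakGradient.comp`). It is obtained by mollification, which uses only that `Ω` is
open and of finite measure.

For the separation property, the graph of `β` is closed by lower semicontinuity, so the set where
`β` has a value in `[-K, K]` is compact when `D(β)` is bounded, and it is contained in `D(β)`.
-/

namespace CahnHilliardOono

open scoped Convolution

/-! ### Mollification -/

/-- A sequence of bump functions on `ℝ^d` whose supports shrink to the origin. The ratio of the two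
radii is constant, as the almost everywhere convergence of the mollifications requires. -/
noncomputable def mollifier (d n : ℕ) : ContDiffBump (0 : Space d) where
  rIn := 1 / ((n : ℝ) + 1)
  rOut := 2 / ((n : ℝ) + 1)
  rIn_pos := by positivity
  rIn_lt_rOut := by
    gcongr
    norm_num

/-- The convolution of `g` with the `n`-th mollifier. -/
noncomputable def mollify {d : ℕ} (n : ℕ) (g : Space d → ℝ) : Space d → ℝ :=
  (mollifier d n).normed volume ⋆[ContinuousLinearMap.lsmul ℝ ℝ, volume] g

lemma tendsto_rOut_mollifier (d : ℕ) :
    Tendsto (fun n => (mollifier d n).rOut) atTop (𝓝 0) := by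
  have h := (tendsto_one_div_add_atTop_nhds_zero_nat (𝕜 := ℝ)).const_mul 2
  simpa [mollifier, div_eq_mul_inv] using h

lemma mollify_apply {d : ℕ} (n : ℕ) (g : Space d → ℝ) (x : Space d) :
    mollify n g x = ∫ y, (mollifier d n).normed volume (x - y) * g y := by
  simp only [mollify, convolution_eq_swap, ContinuousLinearMap.lsmul_apply, smul_eq_mul]

lemma contDiff_mollify {d : ℕ} (n : ℕ) {g : Space d → ℝ} (hg : LocallyIntegrable g volume) :
    ContDiff ℝ ∞ (mollify n g) :=
  (mollifier d n).hasCompactSupport_normed.contDiff_convolution_left _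
    (mollifier d n).contDiff_normed hg

lemma fderiv_mollify_apply {d : ℕ} (n : ℕ) {g : Space d → ℝ} (hg : LocallyIntegrable g volume)
    (x e : Space d) :
    fderiv ℝ (mollify n g) x e
      = ∫ y, fderiv ℝ ((mollifier d n).normed volume) (x - y) e * g y := by
  have hs := (mollifier d n).hasCompactSupport_normed (μ := volume)
  have hc : ContDiff ℝ 1 ((mollifier d n).normed volume) := (mollifier d n).contDiff_normed
  have h := hs.hasFDerivAt_convolution_right (ContinuousLinearMap.lsmul ℝ ℝ).flip hg hc x
  rw [convolution_flip] at h
  rw [mollify, h.fderiv, convolution_precompR_apply _ hg (hs.fderiv ℝ)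
    (hc.continuous_fderiv one_ne_zero), convolution_flip, convolution_eq_swap]
  simp only [ContinuousLinearMap.lsmul_apply, smul_eq_mul]

lemma ae_tendsto_mollify {d : ℕ} {g : Space d → ℝ} (hg : LocallyIntegrable g volume) :
    ∀ᵐ x, Tendsto (fun n => mollify n g x) atTop (𝓝 (g x)) := by
  refine ContDiffBump.ae_convolution_tendsto_right_of_locallyIntegrable (K := 2)
    (tendsto_rOut_mollifier d) (Eventually.of_forall fun n => le_of_eq ?_) hg
  simp [mollifier, div_eq_mul_inv]

lemma integrable_mollify {d : ℕ} (n : ℕ) {g : Space d → ℝ} (hg : Integrable g) :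
    Integrable (mollify n g) :=
  (mollifier d n).integrable_normed.integrable_convolution _ hg

lemma integrable_mollifier_mul {d : ℕ} (n : ℕ) {g : Space d → ℝ}
    (hg : LocallyIntegrable g volume) (x : Space d) :
    Integrable (fun y => (mollifier d n).normed volume (x - y) * g y) := by
  have h := (mollifier d n).hasCompactSupport_normed (μ := volume)
    |>.convolutionExists_left (ContinuousLinearMap.lsmul ℝ ℝ) (mollifier d n).continuous_normed hg x
  simpa using h.integrable_swap

lemma mollify_sub {d : ℕ} (n : ℕ) {g k : Space d → ℝ} (hg : LocallyIntegrable g volume)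
    (hk : LocallyIntegrable k volume) (x : Space d) :
    mollify n (fun y => g y - k y) x = mollify n g x - mollify n k x := by
  simp only [mollify_apply, mul_sub]
  exact integral_sub (integrable_mollifier_mul n hg x) (integrable_mollifier_mul n hk x)

lemma abs_mollify_le {d : ℕ} (n : ℕ) (g : Space d → ℝ) (x : Space d) :
    |mollify n g x| ≤ mollify n (fun y => |g y|) x := by
  rw [mollify_apply, mollify_apply]
  refine (abs_integral_le_integral_abs).trans (le_of_eq (integral_congr_ae ?_))
  filter_upwards with y
  rw [abs_mul, abs_of_nonneg ((mollifier d n).nonneg_normed _)]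

lemma integral_abs_mollify_le {d : ℕ} (n : ℕ) {g : Space d → ℝ} (hg : Integrable g) :
    ∫ x, |mollify n g x| ≤ ∫ x, |g x| := by
  calc ∫ x, |mollify n g x| ≤ ∫ x, mollify n (fun y => |g y|) x :=
        integral_mono (integrable_mollify n hg).abs (integrable_mollify n hg.abs)
          (abs_mollify_le n g)
    _ = ∫ x, |g x| := by
        have h := integral_convolution (ContinuousLinearMap.lsmul ℝ ℝ)
          ((mollifier d n).integrable_normed (μ := volume)) hg.abs
        rw [(mollifier d n).integral_normed] at h
        simpa [mollify] using h

/-- The mollifications of an integrable function converge to it in `L¹` of each set of finite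
measure: up to a small `L¹` error, the function is continuous with compact support, and the
mollifications of such a function converge uniformly. -/
lemma tendsto_setIntegral_abs_mollify_sub {d : ℕ} {g : Space d → ℝ} (hg : Integrable g)
    {s : Set (Space d)} (hs : volume s ≠ ⊤) :
    Tendsto (fun n => ∫ x in s, |mollify n g x - g x|) atTop (𝓝 0) := by
  rw [Metric.tendsto_atTop]
  intro ε hε
  obtain ⟨k, hks, hk, hkc, hki⟩ := hg.exists_hasCompactSupport_integral_sub_le
    (show 0 < ε / 4 by positivity)
  simp only [Real.norm_eq_abs] at hk
  set η : ℝ := ε / (4 * (volume.real s + 1)) with hη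
  have hη0 : 0 < η := by positivity
  obtain ⟨δ, hδ, hδ'⟩ := Metric.uniformContinuous_iff.1 (hks.uniformContinuous_of_continuous hkc)
    η hη0
  obtain ⟨m, hm⟩ := eventually_atTop.1 ((tendsto_rOut_mollifier d).eventually (gt_mem_nhds hδ))
  refine ⟨m, fun n hn => ?_⟩
  have hunif : ∀ x, |mollify n k x - k x| ≤ η := fun x =>
    (mollifier d n).dist_normed_convolution_le hkc.aestronglyMeasurable fun y hy =>
      (hδ' ((Metric.mem_ball.1 hy).trans (hm n hn))).le
  have hgk : Integrable (fun y => g y - k y) := hg.sub hki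
  have hs' : IsFiniteMeasure (volume.restrict s) := ⟨by simpa using hs.lt_top⟩
  have hpt : ∀ x, |mollify n g x - g x|
      ≤ |mollify n (fun y => g y - k y) x| + η + |g x - k x| := by
    intro x
    have e : mollify n g x - g x = mollify n (fun y => g y - k y) x
        + (mollify n k x - k x) - (g x - k x) := by
      rw [mollify_sub n hg.locallyIntegrable hki.locallyIntegrable]
      ring
    rw [e]
    refine (abs_sub _ _).trans ?_
    gcongr
    exact (abs_add_le _ _).trans (by gcongr; exact hunif x)
  have i1 := (integrable_mollify n hgk).abs
  have i2 := hgk.abs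
  have hle : ∫ x in s, |mollify n g x - g x| ≤ ε / 4 + ε / 4 + ε / 4 := by
    calc ∫ x in s, |mollify n g x - g x|
        ≤ ∫ x in s, (|mollify n (fun y => g y - k y) x| + η + |g x - k x|) :=
          integral_mono ((integrable_mollify n hg).sub hg).abs.integrableOn
            ((i1.integrableOn.add (integrable_const η)).add i2.integrableOn) hpt
      _ = (∫ x in s, |mollify n (fun y => g y - k y) x|) + volume.real s * η
            + ∫ x in s, |g x - k x| := by
          have j1 := i1.integrableOn (s := s)
          have j2 := j1.add (integrable_const η)
          have h1 := integral_add j2 (i2.integrableOn (s := s))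
          have h2 := integral_add j1 (integrable_const (μ := volume.restrict s) η)
          simp only [Pi.add_apply] at h1
          rw [h1, h2]
          simp
      _ ≤ ε / 4 + ε / 4 + ε / 4 := by
          gcongr
          · exact (setIntegral_le_integral i1 (Eventually.of_forall fun x => abs_nonneg _)).trans
              ((integral_abs_mollify_le n hgk).trans hk)
          · have h0 : 0 ≤ volume.real s := measureReal_nonneg
            rw [hη, mul_div_assoc', div_le_div_iff₀ (by positivity) (by norm_num)]
            nlinarith
          · exact (setIntegral_le_integral i2 (Eventually.of_forall fun x => abs_nonneg _)).trans hk
  rw [Real.dist_0_eq_abs, abs_of_nonneg (integral_nonneg fun x => abs_nonneg _)]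
  linarith

/-- For `x` in a compact subset of `Ω`, the translate `y ↦ ρₙ (x - y)` of the mollifier is a test
function on `Ω` as soon as `n` is large. -/
lemma eventually_isTestFunction_mollifier {d : ℕ} {Ω K : Set (Space d)} (hΩ : IsOpen Ω)
    (hK : IsCompact K) (hKΩ : K ⊆ Ω) :
    ∀ᶠ n in atTop, ∀ x ∈ K,
      IsTestFunction Ω (fun y => (mollifier d n).normed volume (x - y)) := by
  obtain ⟨δ, hδ, hδΩ⟩ := hK.exists_cthickening_subset_open hΩ hKΩ
  filter_upwards [(tendsto_rOut_mollifier d).eventually (gt_mem_nhds hδ)] with n hn x hx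
  have hsub : tsupport (fun y => (mollifier d n).normed volume (x - y))
      ⊆ Metric.closedBall x (mollifier d n).rOut := by
    refine closure_minimal (fun y hy => ?_) Metric.isClosed_closedBall
    have h : x - y ∈ Function.support ((mollifier d n).normed volume) := hy
    rw [(mollifier d n).support_normed_eq, mem_ball_zero_iff] at h
    rw [Metric.mem_closedBall, dist_comm, dist_eq_norm]
    exact h.le
  refine ⟨(mollifier d n).contDiff_normed.comp (contDiff_const.sub contDiff_id),
    HasCompactSupport.of_support_subset_isCompact (isCompact_closedBall x _)
      ((subset_tsupport _).trans hsub), hsub.trans (Subset.trans ?_ hδΩ)⟩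
  exact (Metric.closedBall_subset_closedBall hn.le).trans
    (Metric.closedBall_subset_cthickening hx δ)

/-- An integrable function on an open set is nonnegative almost everywhere there if its integrals
against the nonnegative test functions are nonnegative. -/
lemma ae_nonneg_of_forall_integral_mul_testFunction_nonneg {d : ℕ} {Ω : Set (Space d)}
    (hΩ : IsOpen Ω) {f : Space d → ℝ} (hf : IntegrableOn f Ω)
    (h : ∀ ζ : Space d → ℝ, IsTestFunction Ω ζ → (∀ x, 0 ≤ ζ x) → 0 ≤ ∫ x in Ω, f x * ζ x) :
    ∀ᵐ x ∂volume.restrict Ω, 0 ≤ f x := by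
  have hi : Integrable (Ω.indicator f) := hf.integrable_indicator hΩ.measurableSet
  rw [ae_restrict_iff' hΩ.measurableSet]
  filter_upwards [ae_tendsto_mollify hi.locallyIntegrable] with x hx hxΩ
  rw [indicator_of_mem hxΩ] at hx
  refine ge_of_tendsto hx ?_
  filter_upwards [eventually_isTestFunction_mollifier hΩ isCompact_singleton
    (singleton_subset_iff.2 hxΩ)] with n hn
  have h1 := h _ (hn x rfl) fun y => (mollifier d n).nonneg_normed _
  rw [← integral_indicator hΩ.measurableSet] at h1
  rw [mollify_apply]
  refine h1.trans_eq (integral_congr_ae (Eventually.of_forall fun y => ?_))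
  by_cases hy : y ∈ Ω <;> simp [hy, mul_comm]

/-! ### Weak derivatives -/

/-- On a compact subset of `Ω`, mollification commutes eventually with the weak derivative: the
translates of the mollifier are admissible test functions. -/
lemma eventually_fderiv_mollify {d : ℕ} {Ω K : Set (Space d)} (hΩ : IsOpen Ω)
    (hK : IsCompact K) (hKΩ : K ⊆ Ω) {v g : Space d → ℝ} {e : Space d}
    (hv : IntegrableOn v Ω)
    (h : ∀ ψ : Space d → ℝ, IsTestFunction Ω ψ →
      ∫ x in Ω, v x * fderiv ℝ ψ x e = - ∫ x in Ω, g x * ψ x) :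
    ∀ᶠ n in atTop, ∀ x ∈ K,
      fderiv ℝ (mollify n (Ω.indicator v)) x e = mollify n (Ω.indicator g) x := by
  have hvi : Integrable (Ω.indicator v) := hv.integrable_indicator hΩ.measurableSet
  filter_upwards [eventually_isTestFunction_mollifier hΩ hK hKΩ] with n hn x hx
  have h1 := h _ (hn x hx)
  rw [fderiv_mollify_apply n hvi.locallyIntegrable, mollify_apply]
  have hd : ∀ y, fderiv ℝ (fun y => (mollifier d n).normed volume (x - y)) y e
      = - fderiv ℝ ((mollifier d n).normed volume) (x - y) e := by
    intro y
    have hD := ((mollifier d n).contDiff_normed (μ := volume) (n := 1)).differentiable one_ne_zero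
    have h2 := (hD (x - y)).hasFDerivAt.comp y ((hasFDerivAt_id y).const_sub x)
    rw [HasFDerivAt.fderiv (f := fun y => (mollifier d n).normed volume (x - y)) h2]
    simp
  rw [← integral_indicator hΩ.measurableSet, ← integral_indicator hΩ.measurableSet] at h1
  have e1 : ∫ y, fderiv ℝ ((mollifier d n).normed volume) (x - y) e * Ω.indicator v y
      = - ∫ y, Ω.indicator (fun y =>
        v y * fderiv ℝ (fun y => (mollifier d n).normed volume (x - y)) y e) y := by
    rw [← integral_neg]
    refine integral_congr_ae (Eventually.of_forall fun y => ?_)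
    by_cases hy : y ∈ Ω <;> simp [hy, hd, mul_comm]
  have e2 : ∫ y, (mollifier d n).normed volume (x - y) * Ω.indicator g y
      = ∫ y, Ω.indicator (fun y => g y * (mollifier d n).normed volume (x - y)) y := by
    refine integral_congr_ae (Eventually.of_forall fun y => ?_)
    by_cases hy : y ∈ Ω <;> simp [hy, mul_comm]
  rw [e1, e2, h1, neg_neg]

lemma IsTestFunction.setIntegral_mul_eq {d : ℕ} {Ω : Set (Space d)} {ψ : Space d → ℝ}
    (hψ : IsTestFunction Ω ψ) (w : Space d → ℝ) :
    ∫ x in Ω, w x * ψ x = ∫ x, w x * ψ x :=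
  setIntegral_eq_integral_of_forall_compl_eq_zero fun x hx => by
    rw [image_eq_zero_of_notMem_tsupport fun h => hx (hψ.tsupport_subset h), mul_zero]

lemma IsTestFunction.fderiv_apply {d : ℕ} {Ω : Set (Space d)} {ψ : Space d → ℝ}
    (hψ : IsTestFunction Ω ψ) (e : Space d) : IsTestFunction Ω (fun x => fderiv ℝ ψ x e) :=
  ⟨(hψ.contDiff.fderiv_right (m := ∞) (by simp)).clm_apply contDiff_const,
    hψ.hasCompactSupport.fderiv_apply ℝ e,
    (tsupport_fderiv_apply_subset ℝ e).trans hψ.tsupport_subset⟩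

lemma IsTestFunction.mul {d : ℕ} {Ω : Set (Space d)} {ζ ψ : Space d → ℝ}
    (hζ : IsTestFunction Ω ζ) (hψ : IsTestFunction Ω ψ) : IsTestFunction Ω (fun x => ζ x * ψ x) :=
  ⟨hζ.contDiff.mul hψ.contDiff, hψ.hasCompactSupport.mul_left,
    (tsupport_mul_subset_right).trans hψ.tsupport_subset⟩

lemma IsTestFunction.exists_bound {d : ℕ} {Ω : Set (Space d)} {ψ : Space d → ℝ}
    (hψ : IsTestFunction Ω ψ) : ∃ P, ∀ x, |ψ x| ≤ P :=
  hψ.hasCompactSupport.exists_bound_of_continuous hψ.contDiff.continuous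

/-- Chain rule for weak partial derivatives. Integrate by parts with the mollifications of `v`, for
which the classical chain rule holds, and pass to the limit. -/
lemma integral_comp_mul_fderiv_testFunction {d : ℕ} {Ω : Set (Space d)} (hΩ : IsOpen Ω)
    (hfin : volume Ω ≠ ⊤) {v g : Space d → ℝ} {e : Space d}
    (hv : IntegrableOn v Ω) (hg : IntegrableOn g Ω)
    (h : ∀ ψ : Space d → ℝ, IsTestFunction Ω ψ →
      ∫ x in Ω, v x * fderiv ℝ ψ x e = - ∫ x in Ω, g x * ψ x)
    {f : ℝ → ℝ} (hf : ContDiff ℝ 1 f) {B L : ℝ} (hB : ∀ r, |f r| ≤ B) (hL : ∀ r, |deriv f r| ≤ L)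
    {ψ : Space d → ℝ} (hψ : IsTestFunction Ω ψ) :
    ∫ x in Ω, f (v x) * fderiv ℝ ψ x e = - ∫ x in Ω, deriv f (v x) * g x * ψ x := by
  have hvi : Integrable (Ω.indicator v) := hv.integrable_indicator hΩ.measurableSet
  have hgi : Integrable (Ω.indicator g) := hg.integrable_indicator hΩ.measurableSet
  have hfinite : IsFiniteMeasure (volume.restrict Ω) := ⟨by simpa using hfin.lt_top⟩
  obtain ⟨P, hP⟩ := hψ.exists_bound
  have hψ' := hψ.fderiv_apply e
  obtain ⟨P', hP'⟩ := hψ'.exists_bound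
  have hf' : Continuous (deriv f) := hf.continuous_deriv_one
  have hVc : ∀ n, ContDiff ℝ ∞ (mollify n (Ω.indicator v)) := fun n =>
    contDiff_mollify n hvi.locallyIntegrable
  have hGc : ∀ n, Continuous (mollify n (Ω.indicator g)) := fun n =>
    (contDiff_mollify n hgi.locallyIntegrable).continuous
  have hψc := hψ.contDiff.continuous
  have hψ'c := hψ'.contDiff.continuous
  have hL0 : 0 ≤ L := (abs_nonneg _).trans (hL 0)
  have hP0 : 0 ≤ P := (abs_nonneg _).trans (hP 0)
  have hae : ∀ᵐ x ∂volume.restrict Ω,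
      Tendsto (fun n => mollify n (Ω.indicator v) x) atTop (𝓝 (v x)) := by
    rw [ae_restrict_iff' hΩ.measurableSet]
    filter_upwards [ae_tendsto_mollify hvi.locallyIntegrable] with x hx hxΩ
    rwa [indicator_of_mem hxΩ] at hx
  have hbyparts : ∀ᶠ n in atTop,
      ∫ x in Ω, f (mollify n (Ω.indicator v) x) * fderiv ℝ ψ x e
        = - ∫ x in Ω, deriv f (mollify n (Ω.indicator v) x) * mollify n (Ω.indicator g) x * ψ x := by
    filter_upwards [eventually_fderiv_mollify hΩ hψ.hasCompactSupport.isCompact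
      hψ.tsupport_subset hv h] with n hn
    rw [hψ'.setIntegral_mul_eq, hψ.setIntegral_mul_eq]
    have hfV : ContDiff ℝ 1 (fun x => f (mollify n (Ω.indicator v) x)) :=
      hf.comp ((hVc n).of_le (by simp))
    have hd : ∀ x, fderiv ℝ (fun x => f (mollify n (Ω.indicator v) x)) x e
        = deriv f (mollify n (Ω.indicator v) x) * fderiv ℝ (mollify n (Ω.indicator v)) x e := by
      intro x
      have h1 := ((hf.differentiable one_ne_zero) (mollify n (Ω.indicator v) x)).hasDerivAt
      have h2 := (((hVc n).differentiable (by simp)) x).hasFDerivAt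
      have h3 := h1.comp_hasFDerivAt x h2
      rw [HasFDerivAt.fderiv (f := fun x => f (mollify n (Ω.indicator v) x)) h3]
      simp
    rw [integral_mul_fderiv_eq_neg_fderiv_mul_of_integrable]
    · congr 1
      refine integral_congr_ae (Eventually.of_forall fun x => ?_)
      by_cases hx : x ∈ tsupport ψ
      · simp only [hd, hn x hx]
      · simp only [image_eq_zero_of_notMem_tsupport hx, mul_zero]
    · exact (((hfV.continuous_fderiv one_ne_zero).clm_apply continuous_const).mul
        hψc).integrable_of_hasCompactSupport hψ.hasCompactSupport.mul_left
    · exact (hfV.continuous.mul hψ'c).integrable_of_hasCompactSupport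
        hψ'.hasCompactSupport.mul_left
    · exact (hfV.continuous.mul hψc).integrable_of_hasCompactSupport hψ.hasCompactSupport.mul_left
    · exact fun x _ => hfV.differentiable one_ne_zero x
    · exact fun x _ => hψ.contDiff.differentiable (by simp) x
  have hlhs : Tendsto (fun n => ∫ x in Ω, f (mollify n (Ω.indicator v) x) * fderiv ℝ ψ x e) atTop
      (𝓝 (∫ x in Ω, f (v x) * fderiv ℝ ψ x e)) := by
    refine tendsto_integral_of_dominated_convergence (fun _ => B * P') (fun n => ?_)
      (integrable_const _) (fun n => Eventually.of_forall fun x => ?_) ?_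
    · exact ((hf.continuous.comp (hVc n).continuous).mul hψ'c).aestronglyMeasurable
    · rw [Real.norm_eq_abs, abs_mul]
      exact mul_le_mul (hB _) (hP' x) (abs_nonneg _) ((abs_nonneg _).trans (hB 0))
    · filter_upwards [hae] with x hx
      exact ((hf.continuous.tendsto _).comp hx).mul_const _
  have hdom : ∀ n x, |deriv f (mollify n (Ω.indicator v) x) * ψ x| ≤ L * P := fun n x => by
    rw [abs_mul]
    exact mul_le_mul (hL _) (hP x) (abs_nonneg _) hL0
  have hmeas : ∀ n, Continuous (fun x => deriv f (mollify n (Ω.indicator v) x) * ψ x) := fun n =>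
    (hf'.comp (hVc n).continuous).mul hψc
  have hrhs1 : Tendsto (fun n => ∫ x in Ω, deriv f (mollify n (Ω.indicator v) x) * g x * ψ x) atTop
      (𝓝 (∫ x in Ω, deriv f (v x) * g x * ψ x)) := by
    refine tendsto_integral_of_dominated_convergence (fun x => L * P * |g x|) (fun n => ?_)
      (hg.abs.const_mul _) (fun n => Eventually.of_forall fun x => ?_) ?_
    · exact ((hf'.comp (hVc n).continuous).aestronglyMeasurable.mul hg.aestronglyMeasurable).mul
        hψc.aestronglyMeasurable
    · rw [mul_right_comm, Real.norm_eq_abs, abs_mul]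
      gcongr
      exact hdom n x
    · filter_upwards [hae] with x hx
      exact (((hf'.tendsto _).comp hx).mul_const _).mul_const _
  have hrhs2 : Tendsto (fun n => ∫ x in Ω, deriv f (mollify n (Ω.indicator v) x) *
      (mollify n (Ω.indicator g) x - g x) * ψ x) atTop (𝓝 0) := by
    have hlim := (tendsto_setIntegral_abs_mollify_sub hgi hfin).const_mul (L * P)
    rw [mul_zero] at hlim
    refine squeeze_zero_norm (fun n => ?_) hlim
    rw [← integral_const_mul]
    refine (norm_integral_le_integral_norm _).trans (integral_mono_of_nonneg
      (Eventually.of_forall fun x => norm_nonneg _)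
      (((integrable_mollify n hgi).sub hgi).abs.integrableOn.const_mul _) ?_)
    filter_upwards [ae_restrict_mem hΩ.measurableSet] with x hx
    rw [mul_right_comm, Real.norm_eq_abs, abs_mul, indicator_of_mem hx]
    gcongr
    exact hdom n x
  have hrhs : Tendsto (fun n => ∫ x in Ω, deriv f (mollify n (Ω.indicator v) x) *
      mollify n (Ω.indicator g) x * ψ x) atTop (𝓝 (∫ x in Ω, deriv f (v x) * g x * ψ x)) := by
    have hsum := hrhs2.add hrhs1
    rw [zero_add] at hsum
    refine hsum.congr fun n => ?_
    have i1 : Integrable (fun x => deriv f (mollify n (Ω.indicator v) x) * g x * ψ x)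
        (volume.restrict Ω) := by
      have := Integrable.bdd_mul (c := L * P) hg (hmeas n).aestronglyMeasurable
        (Eventually.of_forall fun x => hdom n x)
      exact this.congr (Eventually.of_forall fun x => mul_right_comm _ _ _)
    have i2 : Integrable (fun x => deriv f (mollify n (Ω.indicator v) x) *
        (mollify n (Ω.indicator g) x - g x) * ψ x) (volume.restrict Ω) := by
      have := Integrable.bdd_mul (c := L * P) ((integrable_mollify n hgi).integrableOn.sub hg)
        (hmeas n).aestronglyMeasurable (Eventually.of_forall fun x => hdom n x)
      exact this.congr (Eventually.of_forall fun x => mul_right_comm _ _ _)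
    rw [← integral_add i2 i1]
    refine integral_congr_ae (Eventually.of_forall fun x => ?_)
    simp only
    ring
  exact tendsto_nhds_unique (hlhs.congr' hbyparts) hrhs.neg

/-- Chain rule in `H¹`. The bounds on `f` and on its derivative make the result square integrable on
a set of finite measure. -/
lemma IsWeakGradient.comp {d : ℕ} {Ω : Set (Space d)} (hΩ : IsOpen Ω) (hfin : volume Ω ≠ ⊤)
    {v : Space d → ℝ} {G : Space d → Space d} (h : IsWeakGradient Ω v G)
    (hv : MemLp v 2 (volume.restrict Ω)) (hG : MemLp G 2 (volume.restrict Ω))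
    {f : ℝ → ℝ} (hf : ContDiff ℝ 1 f) {B L : ℝ} (hB : ∀ r, |f r| ≤ B)
    (hL : ∀ r, |deriv f r| ≤ L) :
    IsWeakGradient Ω (fun x => f (v x)) (fun x => deriv f (v x) • G x) := by
  have hfinite : IsFiniteMeasure (volume.restrict Ω) := ⟨by simpa using hfin.lt_top⟩
  intro ψ hψ i
  simp only [PiLp.smul_apply, smul_eq_mul]
  exact integral_comp_mul_fderiv_testFunction hΩ hfin (hv.integrable one_le_two)
    ((memLp_coord hG i).integrable one_le_two) (fun ψ hψ => h ψ hψ i) hf hB hL hψ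

lemma gradient_apply {d : ℕ} {ζ : Space d → ℝ} (x : Space d) (i : Fin d) :
    gradient ζ x i = fderiv ℝ ζ x (EuclideanSpace.single i 1) := by
  rw [← inner_gradient_left, EuclideanSpace.inner_single_right]
  simp

/-- Product of a function with a weak gradient and a test function. -/
lemma IsWeakGradient.mul_testFunction {d : ℕ} {Ω : Set (Space d)}
    {v : Space d → ℝ} {G : Space d → Space d} (h : IsWeakGradient Ω v G)
    (hv : MemLp v 2 (volume.restrict Ω)) (hG : MemLp G 2 (volume.restrict Ω))
    {ζ : Space d → ℝ} (hζ : IsTestFunction Ω ζ) :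
    IsWeakGradient Ω (fun x => v x * ζ x) (fun x => ζ x • G x + v x • gradient ζ x) := by
  intro ψ hψ i
  have hζψ := hζ.mul hψ
  set e : Space d := EuclideanSpace.single i 1
  have hd : ∀ x, fderiv ℝ (fun x => ζ x * ψ x) x e
      = ζ x * fderiv ℝ ψ x e + ψ x * fderiv ℝ ζ x e := by
    intro x
    rw [fderiv_fun_mul (hζ.contDiff.differentiable (by simp) x)
      (hψ.contDiff.differentiable (by simp) x)]
    simp
  have h1 := h _ hζψ i
  have i1 := hv.integrable_mul ((hζψ).memLp_fderiv e)
  have i2 := hv.integrable_mul (hψ.mul (hζ.fderiv_apply e)).memLp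
  have i3 := (memLp_coord hG i).integrable_mul hζψ.memLp
  have e1 : ∫ x in Ω, v x * ζ x * fderiv ℝ ψ x e
      = (∫ x in Ω, v x * fderiv ℝ (fun x => ζ x * ψ x) x e)
        - ∫ x in Ω, v x * (ψ x * fderiv ℝ ζ x e) := by
    have s1 := integral_sub i1 i2
    simp only [Pi.mul_apply] at s1
    rw [← s1]
    refine integral_congr_ae (Eventually.of_forall fun x => ?_)
    simp only [hd]
    ring
  have e2 : ∫ x in Ω, (ζ x • G x + v x • gradient ζ x) i * ψ x
      = (∫ x in Ω, G x i * (ζ x * ψ x)) + ∫ x in Ω, v x * (ψ x * fderiv ℝ ζ x e) := by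
    have s2 := integral_add i3 i2
    simp only [Pi.mul_apply] at s2
    rw [← s2]
    refine integral_congr_ae (Eventually.of_forall fun x => ?_)
    simp only [PiLp.add_apply, PiLp.smul_apply, smul_eq_mul, gradient_apply]
    ring
  rw [e1, e2, h1]
  ring

lemma H1.memLp_val {d : ℕ} {Ω : Set (Space d)} (z : H1 Ω) :
    MemLp z.val 2 (volume.restrict Ω) := Lp.memLp _

lemma H1.memLp_grad {d : ℕ} {Ω : Set (Space d)} (z : H1 Ω) :
    MemLp z.grad 2 (volume.restrict Ω) := Lp.memLp _

lemma H1.isWeakGradient {d : ℕ} {Ω : Set (Space d)} (z : H1 Ω) :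
    IsWeakGradient Ω z.val z.grad :=
  Subtype.prop (p := (· ∈ h1Submodule Ω)) z

lemma IsWeakGradient.exists_H1 {d : ℕ} {Ω : Set (Space d)} {v : Space d → ℝ}
    {G : Space d → Space d} (h : IsWeakGradient Ω v G)
    (hv : MemLp v 2 (volume.restrict Ω)) (hG : MemLp G 2 (volume.restrict Ω)) :
    ∃ z : H1 Ω, z.val =ᵐ[volume.restrict Ω] v ∧ z.grad =ᵐ[volume.restrict Ω] G :=
  ⟨(⟨WithLp.toLp 2 (hv.toLp v, hG.toLp G),
    h.congr hv.coeFn_toLp.symm hG.coeFn_toLp.symm⟩ : h1Submodule Ω),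
    hv.coeFn_toLp, hG.coeFn_toLp⟩

/-! ### The stationary inclusion -/

lemma H1.exists_comp {d : ℕ} {Ω : Set (Space d)} (hΩ : IsOpen Ω) (hfin : volume Ω ≠ ⊤)
    (z : H1 Ω) {f : ℝ → ℝ} (hf : ContDiff ℝ 1 f) {B L : ℝ} (hB : ∀ r, |f r| ≤ B)
    (hL : ∀ r, |deriv f r| ≤ L) :
    ∃ w : H1 Ω, w.val =ᵐ[volume.restrict Ω] (fun x => f (z.val x)) ∧
      w.grad =ᵐ[volume.restrict Ω] (fun x => deriv f (z.val x) • z.grad x) := by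
  have hfinite : IsFiniteMeasure (volume.restrict Ω) := ⟨by simpa using hfin.lt_top⟩
  have hm := z.memLp_val.aestronglyMeasurable
  refine (z.isWeakGradient.comp hΩ hfin z.memLp_val z.memLp_grad hf hB hL).exists_H1 ?_ ?_
  · exact MemLp.of_bound (hf.continuous.comp_aestronglyMeasurable hm) B
      (Eventually.of_forall fun x => hB _)
  · refine z.memLp_grad.of_le_mul (c := L)
      ((hf.continuous_deriv_one.comp_aestronglyMeasurable hm).smul
        z.memLp_grad.aestronglyMeasurable) (Eventually.of_forall fun x => ?_)
    rw [norm_smul]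
    exact mul_le_mul_of_nonneg_right (hL _) (norm_nonneg _)

lemma IsTestFunction.continuous_gradient {d : ℕ} {Ω : Set (Space d)} {ζ : Space d → ℝ}
    (hζ : IsTestFunction Ω ζ) : Continuous (gradient ζ) :=
  (InnerProductSpace.toDual ℝ (Space d)).symm.continuous.comp
    (hζ.contDiff.continuous_fderiv (by simp))

lemma IsTestFunction.exists_gradient_bound {d : ℕ} {Ω : Set (Space d)} {ζ : Space d → ℝ}
    (hζ : IsTestFunction Ω ζ) : ∃ P, ∀ x, ‖gradient ζ x‖ ≤ P := by
  obtain ⟨P, hP⟩ := (hζ.hasCompactSupport.fderiv ℝ).exists_bound_of_continuous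
    (hζ.contDiff.continuous_fderiv (by simp))
  exact ⟨P, fun x => by simpa [gradient] using hP x⟩

lemma H1.exists_mul_testFunction {d : ℕ} {Ω : Set (Space d)} (w : H1 Ω) {ζ : Space d → ℝ}
    (hζ : IsTestFunction Ω ζ) :
    ∃ y : H1 Ω, y.val =ᵐ[volume.restrict Ω] (fun x => w.val x * ζ x) ∧
      y.grad =ᵐ[volume.restrict Ω] (fun x => ζ x • w.grad x + w.val x • gradient ζ x) := by
  obtain ⟨P, hP⟩ := hζ.exists_bound
  obtain ⟨P', hP'⟩ := hζ.exists_gradient_bound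
  have hζm : AEStronglyMeasurable ζ (volume.restrict Ω) :=
    hζ.contDiff.continuous.aestronglyMeasurable
  refine (w.isWeakGradient.mul_testFunction w.memLp_val w.memLp_grad hζ).exists_H1 ?_ (.add ?_ ?_)
  · refine w.memLp_val.of_le_mul (c := P) (w.memLp_val.aestronglyMeasurable.mul hζm)
      (Eventually.of_forall fun x => ?_)
    rw [norm_mul, mul_comm]
    exact mul_le_mul_of_nonneg_right (hP x) (norm_nonneg _)
  · refine w.memLp_grad.of_le_mul (c := P) (hζm.smul w.memLp_grad.aestronglyMeasurable)
      (Eventually.of_forall fun x => ?_)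
    rw [norm_smul]
    exact mul_le_mul_of_nonneg_right (hP x) (norm_nonneg _)
  · refine w.memLp_val.of_le_mul (c := P') (w.memLp_val.aestronglyMeasurable.smul
      hζ.continuous_gradient.aestronglyMeasurable) (Eventually.of_forall fun x => ?_)
    rw [norm_smul, mul_comm]
    exact mul_le_mul_of_nonneg_right (hP' x) (norm_nonneg _)

lemma integrable_inner_of_memLp {d : ℕ} {m : Measure (Space d)} {G K : Space d → Space d}
    (hG : MemLp G 2 m) (hK : MemLp K 2 m) : Integrable (fun x => inner ℝ (G x) (K x)) m := by
  refine (hG.norm.integrable_mul hK.norm).mono'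
    (hG.aestronglyMeasurable.inner hK.aestronglyMeasurable)
    (Eventually.of_forall fun x => norm_inner_le_norm _ _)

/-- Two integrations by parts: `∫ ∇w · ∇ζ = - ∫ w Δζ`. -/
lemma IsWeakGradient.integral_inner_gradient {d : ℕ} {Ω : Set (Space d)} {w : Space d → ℝ}
    {G : Space d → Space d} (h : IsWeakGradient Ω w G) (hG : MemLp G 2 (volume.restrict Ω))
    {ζ : Space d → ℝ} (hζ : IsTestFunction Ω ζ) :
    ∫ x in Ω, inner ℝ (G x) (gradient ζ x) = - ∑ i, ∫ x in Ω, w x *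
      fderiv ℝ (fun y => fderiv ℝ ζ y (EuclideanSpace.single i 1)) x
        (EuclideanSpace.single i 1) := by
  have h1 : ∀ i, ∫ x in Ω, G x i * fderiv ℝ ζ x (EuclideanSpace.single i 1)
      = - ∫ x in Ω, w x * fderiv ℝ (fun y => fderiv ℝ ζ y (EuclideanSpace.single i 1)) x
        (EuclideanSpace.single i 1) := fun i => by
    rw [h _ (hζ.fderiv_apply _) i, neg_neg]
  have hi : ∀ i ∈ Finset.univ, Integrable
      (fun x => G x i * fderiv ℝ ζ x (EuclideanSpace.single i 1)) (volume.restrict Ω) :=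
    fun i _ => (memLp_coord hG i).integrable_mul (hζ.memLp_fderiv _)
  rw [← Finset.sum_neg_distrib, ← Finset.sum_congr rfl fun i _ => h1 i, ← integral_finsetSum _ hi]
  refine integral_congr_ae (Eventually.of_forall fun x => ?_)
  simp only [PiLp.inner_apply, gradient_apply]
  refine Finset.sum_congr rfl fun i _ => ?_
  simp [mul_comm]

/-- If `z ≤ c` solves `-Δz = F` weakly with `F ∈ L²`, then `F ≥ 0` almost everywhere on the contact
set `{z = c}`. The functions `hₙ(z) = 1 / (1 + (n + 1)² (z - c)²)` decrease to the indicator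
function of that set and are nondecreasing in `z` for `z ≤ c`. Testing with `hₙ(z) ζ`, where
`ζ ≥ 0`, gives `∫ F hₙ(z) ζ ≥ ∫ ∇Aₙ(z) · ∇ζ` for the primitive `Aₙ` of `hₙ`, which is an arctangent
and tends to `0` uniformly. -/
lemma ae_nonneg_of_eq_of_ae_le {d : ℕ} {Ω : Set (Space d)} (hΩ : IsOpen Ω) (hfin : volume Ω ≠ ⊤)
    {z : H1 Ω} {F : Space d → ℝ} (hF : MemLp F 2 (volume.restrict Ω))
    (heq : ∀ v : H1 Ω, ∫ x in Ω, inner ℝ (z.grad x) (v.grad x) = ∫ x in Ω, F x * v.val x)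
    {c : ℝ} (hle : ∀ᵐ x ∂volume.restrict Ω, z.val x ≤ c) :
    ∀ᵐ x ∂volume.restrict Ω, z.val x = c → 0 ≤ F x := by
  have hfinite : IsFiniteMeasure (volume.restrict Ω) := ⟨by simpa using hfin.lt_top⟩
  have hzm := z.memLp_val.aestronglyMeasurable
  have hF1 : Integrable F (volume.restrict Ω) := hF.integrable one_le_two
  set hh : ℕ → ℝ → ℝ := fun n s => 1 / (1 + (((n : ℝ) + 1) * (s - c)) ^ 2) with hhh
  set A : ℕ → ℝ → ℝ := fun n s => Real.arctan (((n : ℝ) + 1) * (s - c)) / ((n : ℝ) + 1) with hA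
  have hlin : ∀ n s, HasDerivAt (fun s : ℝ => ((n : ℕ) + 1 : ℝ) * (s - c)) ((n : ℝ) + 1) s := by
    intro n s
    simpa using ((hasDerivAt_id s).sub_const c).const_mul ((n : ℝ) + 1)
  have hAd : ∀ n s, deriv (A n) s = hh n s := by
    intro n s
    rw [((hlin n s).arctan.div_const ((n : ℝ) + 1)).deriv]
    have : (n : ℝ) + 1 ≠ 0 := by positivity
    simp only [hhh]
    field_simp
  have hhd : ∀ n s, deriv (hh n) s
      = - (2 * ((n : ℝ) + 1) * (((n : ℝ) + 1) * (s - c)))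
        / (1 + (((n : ℝ) + 1) * (s - c)) ^ 2) ^ 2 := by
    intro n s
    have h1 := (((hlin n s).pow 2).const_add 1).inv
      (ne_of_gt (by simp only [Pi.pow_apply]; positivity))
    have h2 : hh n = fun s => (1 + (((n : ℝ) + 1) * (s - c)) ^ 2)⁻¹ := by
      funext s
      simp [hhh]
    rw [h2]
    refine (HasDerivAt.deriv h1).trans ?_
    simp only [Pi.pow_apply]
    push_cast
    ring
  have hAc : ∀ n, ContDiff ℝ 1 (A n) := fun n =>
    ((contDiff_const.mul (contDiff_id.sub contDiff_const)).arctan).div_const _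
  have hhc : ∀ n, ContDiff ℝ 1 (hh n) := fun n => by
    refine contDiff_const.div (contDiff_const.add
      ((contDiff_const.mul (contDiff_id.sub contDiff_const)).pow 2)) fun s => ?_
    positivity
  have hAB : ∀ n s, |A n s| ≤ (Real.pi / 2) * (1 / ((n : ℝ) + 1)) := by
    intro n s
    simp only [hA]
    rw [abs_div, abs_of_pos (show (0 : ℝ) < n + 1 by positivity), div_eq_mul_one_div]
    gcongr
    exact abs_le.2 ⟨(Real.neg_pi_div_two_lt_arctan _).le, (Real.arctan_lt_pi_div_two _).le⟩
  have hhB : ∀ n s, |hh n s| ≤ 1 := by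
    intro n s
    simp only [hhh]
    rw [abs_of_nonneg (by positivity), div_le_one (by positivity)]
    nlinarith [sq_nonneg (((n : ℝ) + 1) * (s - c))]
  have hhL : ∀ n s, |deriv (hh n) s| ≤ (n : ℝ) + 1 := by
    intro n s
    rw [hhd]
    set y := ((n : ℝ) + 1) * (s - c)
    have hn : (0 : ℝ) < (n : ℝ) + 1 := by positivity
    rw [abs_div, abs_of_pos (show (0 : ℝ) < (1 + y ^ 2) ^ 2 by positivity),
      div_le_iff₀ (by positivity), abs_neg, abs_mul, abs_of_pos (by positivity : 0 < 2 * ((n : ℝ) + 1)),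
      mul_comm (2 : ℝ), mul_assoc]
    refine mul_le_mul_of_nonneg_left ?_ hn.le
    nlinarith [sq_nonneg (|y| - 1), sq_abs y, sq_nonneg y, sq_nonneg (y ^ 2)]
  set f : Space d → ℝ := fun x => ({c} : Set ℝ).indicator 1 (z.val x) * F x with hf
  have hind : Measurable (({c} : Set ℝ).indicator (1 : ℝ → ℝ)) :=
    measurable_one.indicator (measurableSet_singleton c)
  have hindB : ∀ s, |({c} : Set ℝ).indicator (1 : ℝ → ℝ) s| ≤ 1 := by
    intro s
    by_cases hs : s ∈ ({c} : Set ℝ) <;> simp [hs]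
  have hfi : IntegrableOn f Ω := Integrable.bdd_mul (c := 1) hF1
    (hind.comp_aemeasurable hzm.aemeasurable).aestronglyMeasurable
    (Eventually.of_forall fun x => hindB _)
  have key : ∀ᵐ x ∂volume.restrict Ω, 0 ≤ f x := by
    refine ae_nonneg_of_forall_integral_mul_testFunction_nonneg hΩ hfi fun ζ hζ hζ0 => ?_
    obtain ⟨P, hP⟩ := hζ.exists_bound
    have hζc := hζ.contDiff.continuous
    have hlim : Tendsto (fun n => ∫ x in Ω, F x * (hh n (z.val x) * ζ x)) atTop
        (𝓝 (∫ x in Ω, f x * ζ x)) := by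
      refine tendsto_integral_of_dominated_convergence (fun x => |F x| * (1 * P)) (fun n => ?_)
        (hF1.abs.mul_const _) (fun n => Eventually.of_forall fun x => ?_)
        (Eventually.of_forall fun x => ?_)
      · exact hF1.aestronglyMeasurable.mul
          (((hhc n).continuous.comp_aestronglyMeasurable hzm).mul hζc.aestronglyMeasurable)
      · rw [Real.norm_eq_abs, abs_mul, abs_mul]
        gcongr
        · exact hhB _ _
        · exact hP x
      · have h1 : Tendsto (fun n => hh n (z.val x)) atTop
            (𝓝 (({c} : Set ℝ).indicator 1 (z.val x))) := by
          by_cases hx : z.val x = c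
          · simp [hhh, hx]
          · have hx' : 0 < (z.val x - c) ^ 2 := by
              have := sub_ne_zero.2 hx
              positivity
            rw [indicator_of_notMem (by simpa using hx)]
            have ht : Tendsto (fun n : ℕ => (n : ℝ) + 1) atTop atTop :=
              tendsto_atTop_add_const_right _ _ tendsto_natCast_atTop_atTop
            have ht2 : Tendsto (fun n : ℕ => 1 + ((n : ℝ) + 1) ^ 2 * (z.val x - c) ^ 2) atTop
                atTop :=
              tendsto_atTop_add_const_left _ _
                (((tendsto_pow_atTop two_ne_zero).comp ht).atTop_mul_const hx')
            refine ht2.inv_tendsto_atTop.congr fun n => ?_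
            simp [hhh, mul_pow]
        have h2 := (h1.const_mul (F x)).mul_const (ζ x)
        refine (h2.congr fun n => by ring).trans_eq ?_
        simp only [hf]
        rw [mul_comm (F x)]
    have hlow : ∀ n : ℕ, - ((Real.pi / 2) * (1 / ((n : ℝ) + 1)) * ∑ i, ∫ x in Ω,
        |fderiv ℝ (fun y => fderiv ℝ ζ y (EuclideanSpace.single i 1)) x
          (EuclideanSpace.single i 1)|) ≤ ∫ x in Ω, F x * (hh n (z.val x) * ζ x) := by
      intro n
      obtain ⟨w, hw, hwg⟩ := H1.exists_comp hΩ hfin z (hhc n) (hhB n) (hhL n)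
      obtain ⟨y, hy, hyg⟩ := w.exists_mul_testFunction hζ
      obtain ⟨a, ha, hag⟩ := H1.exists_comp hΩ hfin z (hAc n) (hAB n)
        (fun s => (hAd n s).symm ▸ hhB n s)
      have e1 : ∫ x in Ω, F x * (hh n (z.val x) * ζ x) = ∫ x in Ω, F x * y.val x := by
        refine integral_congr_ae ?_
        filter_upwards [hw, hy] with x h1 h2
        rw [h2, h1]
      have e2 : ∫ x in Ω, inner ℝ (a.grad x) (gradient ζ x)
          ≤ ∫ x in Ω, inner ℝ (z.grad x) (y.grad x) := by
        obtain ⟨P', hP'⟩ := hζ.exists_gradient_bound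
        have hgr : MemLp (gradient ζ) 2 (volume.restrict Ω) :=
          MemLp.of_bound hζ.continuous_gradient.aestronglyMeasurable P' (Eventually.of_forall hP')
        refine integral_mono_ae (integrable_inner_of_memLp a.memLp_grad hgr)
          (integrable_inner_of_memLp z.memLp_grad y.memLp_grad) ?_
        filter_upwards [hle, hw, hwg, hyg, hag] with x h0 h1 h2 h3 h4
        have hpos : 0 ≤ deriv (hh n) (z.val x) := by
          rw [hhd]
          refine div_nonneg (neg_nonneg.2 (mul_nonpos_of_nonneg_of_nonpos (by positivity)
            (mul_nonpos_of_nonneg_of_nonpos (by positivity) (sub_nonpos.2 h0)))) (by positivity)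
        simp only [h4, h3, h2, h1, hAd, inner_add_right, real_inner_smul_right,
          real_inner_smul_left]
        have := mul_nonneg (hζ0 x) (mul_nonneg hpos (real_inner_self_nonneg (x := z.grad x)))
        linarith
      rw [e1, ← heq y]
      refine le_trans ?_ e2
      rw [a.isWeakGradient.integral_inner_gradient a.memLp_grad hζ]
      refine neg_le_neg ?_
      rw [Finset.mul_sum]
      refine Finset.sum_le_sum fun i _ => ?_
      have hii := (((hζ.fderiv_apply (EuclideanSpace.single i 1)).fderiv_apply
        (EuclideanSpace.single i 1)).memLp.integrable one_le_two).abs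
      rw [← integral_const_mul]
      refine (le_abs_self _).trans (abs_integral_le_integral_abs.trans
        (integral_mono_of_nonneg (Eventually.of_forall fun x => abs_nonneg _)
          (hii.const_mul _) ?_))
      filter_upwards [ha] with x hx
      rw [hx, abs_mul]
      gcongr
      exact hAB _ _
    refine le_of_tendsto_of_tendsto' ?_ hlim hlow
    have h0 := ((tendsto_one_div_add_atTop_nhds_zero_nat (𝕜 := ℝ)).const_mul (Real.pi / 2)).mul_const
      (∑ i, ∫ x in Ω, |fderiv ℝ (fun y => fderiv ℝ ζ y (EuclideanSpace.single i 1)) x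
          (EuclideanSpace.single i 1)|)
    simpa using h0.neg
  filter_upwards [key] with x hx hxc
  simpa [hf, hxc] using hx

lemma exists_bound_deriv_smoothTransition :
    ∃ L, ∀ r, |deriv Real.smoothTransition r| ≤ L := by
  have hc : Continuous (deriv Real.smoothTransition) :=
    (Real.smoothTransition.contDiff (n := 1)).continuous_deriv_one
  obtain ⟨L, hL⟩ := (isCompact_Icc (a := (0 : ℝ)) (b := 1)).exists_bound_of_continuousOn
    hc.continuousOn
  refine ⟨max L 0, fun r => ?_⟩
  by_cases hr : r ∈ Icc (0 : ℝ) 1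
  · exact (hL r hr).trans (le_max_left _ _)
  · have h0 : deriv Real.smoothTransition r = 0 := by
      rcases lt_or_gt_of_ne (show r ≠ 0 from fun h => hr (by simp [h])) with h | h
      · have : Real.smoothTransition =ᶠ[𝓝 r] fun _ => 0 := by
          filter_upwards [Iio_mem_nhds h] with s hs
          exact Real.smoothTransition.zero_of_nonpos (le_of_lt hs)
        rw [this.deriv_eq, deriv_const]
      · have h1 : 1 < r := not_le.1 fun h' => hr ⟨h.le, h'⟩
        have : Real.smoothTransition =ᶠ[𝓝 r] fun _ => 1 := by
          filter_upwards [Ioi_mem_nhds h1] with s hs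
          exact Real.smoothTransition.one_of_one_le (le_of_lt hs)
        rw [this.deriv_eq, deriv_const]
    rw [h0, abs_zero]
    exact le_max_right _ _

/-- Weak maximum principle: if `-Δz = F` weakly with homogeneous Neumann condition, and `F < 0`
on `{z > c}`, then `z ≤ c`. The test function is a bounded smooth nondecreasing function of `z` that
vanishes exactly on `{z ≤ c}`. -/
lemma ae_le_of_forall_lt_neg {d : ℕ} {Ω : Set (Space d)} (hΩ : IsOpen Ω) (hfin : volume Ω ≠ ⊤)
    {z : H1 Ω} {F : Space d → ℝ} (hF : MemLp F 2 (volume.restrict Ω))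
    (heq : ∀ v : H1 Ω, ∫ x in Ω, inner ℝ (z.grad x) (v.grad x) = ∫ x in Ω, F x * v.val x)
    {c : ℝ} (hneg : ∀ᵐ x ∂volume.restrict Ω, c < z.val x → F x < 0) :
    ∀ᵐ x ∂volume.restrict Ω, z.val x ≤ c := by
  obtain ⟨L, hL⟩ := exists_bound_deriv_smoothTransition
  have hc : ContDiff ℝ 1 (fun s => Real.smoothTransition (s - c)) :=
    Real.smoothTransition.contDiff.comp (contDiff_id.sub contDiff_const)
  have hd : ∀ s, deriv (fun s => Real.smoothTransition (s - c)) s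
      = deriv Real.smoothTransition (s - c) := fun s => deriv_comp_sub_const _ _ _
  obtain ⟨w, hw, hwg⟩ := H1.exists_comp hΩ hfin z hc (B := 1) (L := L)
    (fun s => by
      rw [abs_of_nonneg (Real.smoothTransition.nonneg _)]
      exact Real.smoothTransition.le_one _)
    (fun s => by rw [hd]; exact hL _)
  have h1 : 0 ≤ ∫ x in Ω, F x * w.val x := by
    rw [← heq w]
    refine integral_nonneg_of_ae ?_
    filter_upwards [hwg] with x hx
    rw [hx, real_inner_smul_right, hd]
    exact mul_nonneg (Real.smoothTransition.monotone.deriv_nonneg) real_inner_self_nonneg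
  have hFw : ∀ᵐ x ∂volume.restrict Ω, 0 ≤ -(F x * w.val x) := by
    filter_upwards [hneg, hw] with x hx hwx
    rw [hwx]
    rcases le_or_gt (z.val x) c with h | h
    · rw [Real.smoothTransition.zero_of_nonpos (sub_nonpos.2 h)]
      simp
    · exact neg_nonneg.2 (mul_nonpos_of_nonpos_of_nonneg (hx h).le (Real.smoothTransition.nonneg _))
  have hint : Integrable (fun x => -(F x * w.val x)) (volume.restrict Ω) :=
    (hF.integrable_mul w.memLp_val).neg
  have h2 : ∫ x in Ω, -(F x * w.val x) = 0 :=
    le_antisymm (by rw [integral_neg]; linarith) (integral_nonneg_of_ae hFw)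
  filter_upwards [(integral_eq_zero_iff_of_nonneg_ae hFw hint).1 h2, hneg, hw] with x h3 h4 h5
  by_contra! h
  have h6 := mul_neg_of_neg_of_pos (h4 h) (Real.smoothTransition.pos_of_pos (sub_pos.2 h))
  simp only [h5, Pi.zero_apply] at h3
  linarith

/-- A solution of `z - Δz + ξ = g` with homogeneous Neumann condition and `ξ ∈ S(z)`, for a monotone
graph `S` with `0 ∈ S(0)`, satisfies `ξ ≤ C` whenever `g ≤ C` and `0 ≤ C`. Let `c ≥ 0` be the
infimum of the `r` at which `S` takes a value above `C`. If `z > c`, then `ξ > C ≥ g`, so that the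
maximum principle gives `z ≤ c`; and where `ξ > C`, then `z = c`, so that `-Δz ≥ 0` there, which
says that `ξ ≤ g - z ≤ C`. -/
lemma ae_le_of_monotone_inclusion {d : ℕ} {Ω : Set (Space d)} (hΩ : IsOpen Ω)
    (hfin : volume Ω ≠ ⊤) {S : ℝ → Set ℝ} (h0 : 0 ∈ S 0)
    (hS : ∀ r r' s s', s ∈ S r → s' ∈ S r' → r < r' → s ≤ s')
    {z : H1 Ω} {g ξ : Space d → ℝ}
    (hF : MemLp (fun x => g x - z.val x - ξ x) 2 (volume.restrict Ω))
    (heq : ∀ v : H1 Ω, ∫ x in Ω, inner ℝ (z.grad x) (v.grad x)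
      = ∫ x in Ω, (g x - z.val x - ξ x) * v.val x)
    (hξ : ∀ᵐ x ∂volume.restrict Ω, ξ x ∈ S (z.val x))
    {C : ℝ} (hC : 0 ≤ C) (hg : ∀ᵐ x ∂volume.restrict Ω, g x ≤ C) :
    ∀ᵐ x ∂volume.restrict Ω, ξ x ≤ C := by
  set R : Set ℝ := {r | ∃ s ∈ S r, C < s} with hR
  have hR0 : ∀ r ∈ R, 0 ≤ r := by
    rintro r ⟨s, hs, hCs⟩
    by_contra! hr
    linarith [hS r 0 s 0 hs h0 hr]
  rcases R.eq_empty_or_nonempty with hE | hne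
  · filter_upwards [hξ] with x hx
    by_contra! h
    have : z.val x ∈ R := ⟨_, hx, h⟩
    simp [hE] at this
  · have hc0 : 0 ≤ sInf R := le_csInf hne hR0
    have hle : ∀ᵐ x ∂volume.restrict Ω, z.val x ≤ sInf R := by
      refine ae_le_of_forall_lt_neg hΩ hfin hF heq ?_
      filter_upwards [hξ, hg] with x hx hgx hlt
      obtain ⟨r, ⟨s, hs, hCs⟩, hr⟩ := exists_lt_of_csInf_lt hne hlt
      linarith [hS r _ s _ hs hx hr]
    filter_upwards [ae_nonneg_of_eq_of_ae_le hΩ hfin hF heq hle, hle, hξ, hg] with x h1 h2 h3 h4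
    by_contra! h
    have h5 : sInf R ≤ z.val x := csInf_le ⟨0, hR0⟩ ⟨_, h3, h⟩
    have h6 := h1 (le_antisymm h2 h5)
    linarith

lemma H1.exists_neg {d : ℕ} {Ω : Set (Space d)} (z : H1 Ω) :
    ∃ w : H1 Ω, w.val =ᵐ[volume.restrict Ω] (fun x => - z.val x) ∧
      w.grad =ᵐ[volume.restrict Ω] (fun x => - z.grad x) :=
  IsWeakGradient.exists_H1 (fun ψ hψ i => by
    have h := z.isWeakGradient ψ hψ i
    simp only [neg_mul, PiLp.neg_apply, integral_neg, h]) z.memLp_val.neg z.memLp_grad.neg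

/-- Two-sided version of `ae_le_of_monotone_inclusion`. -/
lemma ae_abs_le_of_monotone_inclusion {d : ℕ} {Ω : Set (Space d)} (hΩ : IsOpen Ω)
    (hfin : volume Ω ≠ ⊤) {S : ℝ → Set ℝ} (h0 : 0 ∈ S 0)
    (hS : ∀ r r' s s', s ∈ S r → s' ∈ S r' → r < r' → s ≤ s')
    {z : H1 Ω} {g ξ : Space d → ℝ}
    (hF : MemLp (fun x => g x - z.val x - ξ x) 2 (volume.restrict Ω))
    (heq : ∀ v : H1 Ω, ∫ x in Ω, inner ℝ (z.grad x) (v.grad x)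
      = ∫ x in Ω, (g x - z.val x - ξ x) * v.val x)
    (hξ : ∀ᵐ x ∂volume.restrict Ω, ξ x ∈ S (z.val x))
    {C : ℝ} (hC : 0 ≤ C) (hg : ∀ᵐ x ∂volume.restrict Ω, |g x| ≤ C) :
    ∀ᵐ x ∂volume.restrict Ω, |ξ x| ≤ C := by
  have hup := ae_le_of_monotone_inclusion hΩ hfin h0 hS hF heq hξ hC
    (hg.mono fun x hx => (abs_le.1 hx).2)
  obtain ⟨w, hw, hwg⟩ := z.exists_neg
  have hlow : ∀ᵐ x ∂volume.restrict Ω, - ξ x ≤ C := by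
    refine ae_le_of_monotone_inclusion (S := fun r => {s | -s ∈ S (-r)}) (z := w)
      (g := fun x => - g x) (ξ := fun x => - ξ x) hΩ hfin (by simpa using h0)
      (fun r r' s s' hs hs' hr => neg_le_neg_iff.1 (hS _ _ _ _ hs' hs (neg_lt_neg hr)))
      ?_ (fun v => ?_) ?_ hC (hg.mono fun x hx => neg_le.1 (abs_le.1 hx).1)
    · refine hF.neg.ae_eq ?_
      filter_upwards [hw] with x hx
      simp only [Pi.neg_apply, hx]
      ring
    · have e1 : ∫ x in Ω, inner ℝ (w.grad x) (v.grad x)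
          = - ∫ x in Ω, inner ℝ (z.grad x) (v.grad x) := by
        rw [← integral_neg]
        refine integral_congr_ae ?_
        filter_upwards [hwg] with x hx
        rw [hx, inner_neg_left]
      rw [e1, heq v, ← integral_neg]
      refine integral_congr_ae ?_
      filter_upwards [hw] with x hx
      rw [hx]
      ring
    · filter_upwards [hξ, hw] with x hx hwx
      simpa [hwx] using hx
  filter_upwards [hup, hlow] with x h1 h2
  exact abs_le.2 ⟨by linarith, h1⟩

/-! ### The subdifferential -/

lemma mem_subdiff_iff {βhat : ℝ → ℝ≥0∞} {r s : ℝ} :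
    s ∈ subdiff βhat r ↔ βhat r ≠ ⊤ ∧
      ∀ q, βhat q ≠ ⊤ → (βhat r).toReal + s * (q - r) ≤ (βhat q).toReal := by
  refine and_congr_right fun hr => forall_congr' fun q => ?_
  lift βhat r to ℝ≥0 using hr with a
  by_cases hq : βhat q = ⊤
  · simp [hq]
  · lift βhat q to ℝ≥0 using hq with b
    simp only [ENNReal.coe_ne_top, not_false_eq_true, ne_eq, forall_const, ENNReal.coe_toReal]
    rw [EReal.coe_nnreal_eq_coe_real, EReal.coe_nnreal_eq_coe_real]
    norm_cast

lemma IsConvexPart.zero_mem_subdiff {βhat : ℝ → ℝ≥0∞} (hβ : IsConvexPart βhat) :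
    0 ∈ subdiff βhat 0 := by
  rw [mem_subdiff_iff]
  simp [hβ.map_zero]

lemma le_of_mem_subdiff_of_lt {βhat : ℝ → ℝ≥0∞} (r r' s s' : ℝ) (hs : s ∈ subdiff βhat r)
    (hs' : s' ∈ subdiff βhat r') (h : r < r') : s ≤ s' := by
  rw [mem_subdiff_iff] at hs hs'
  have h1 := hs.2 r' hs'.1
  have h2 := hs'.2 r hs.1
  by_contra! h3
  nlinarith [mul_pos (sub_pos.2 h3) (sub_pos.2 h)]

/-- The graph of the subdifferential is closed, so its part over bounded values projects onto a
closed set. -/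
lemma IsConvexPart.isClosed_setOf_mem_subdiff_abs_le {βhat : ℝ → ℝ≥0∞} (hβ : IsConvexPart βhat)
    (K : ℝ) : IsClosed {r | ∃ s ∈ subdiff βhat r, |s| ≤ K} := by
  refine IsSeqClosed.isClosed fun r r₀ hr hlim => ?_
  choose s hs hsK using hr
  obtain ⟨s₀, hs₀, k, hk, hks⟩ := (isCompact_Icc (a := -K) (b := K)).tendsto_subseq
    (fun n => abs_le.1 (hsK n))
  have hlim' := hlim.comp hk.tendsto_atTop
  have key : ∀ y : ℝ, (y < 0 ∨ ENNReal.ofReal y < βhat r₀) → ∀ q, βhat q ≠ ⊤ →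
      y + s₀ * (q - r₀) ≤ (βhat q).toReal := by
    intro y hy q hq
    have hev : ∀ᶠ n in atTop, y ≤ (βhat (r (k n))).toReal := by
      rcases hy with hy | hy
      · exact Eventually.of_forall fun n => hy.le.trans ENNReal.toReal_nonneg
      · filter_upwards [hlim'.eventually (hβ.lsc r₀ _ hy)] with n hn
        exact (ENNReal.ofReal_le_iff_le_toReal (mem_subdiff_iff.1 (hs (k n))).1).1 hn.le
    refine le_of_tendsto ((hks.mul (hlim'.const_sub q)).const_add y) ?_
    filter_upwards [hev] with n hn
    have h2 := (mem_subdiff_iff.1 (hs (k n))).2 q hq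
    simp only [Function.comp_apply]
    linarith
  have htop : βhat r₀ ≠ ⊤ := by
    intro h
    have h1 := key (s₀ * r₀ + 1) (Or.inr (by simp [h])) 0 (by simp [hβ.map_zero])
    simp only [hβ.map_zero, ENNReal.toReal_zero] at h1
    linarith
  refine ⟨s₀, mem_subdiff_iff.2 ⟨htop, fun q hq => ?_⟩, abs_le.2 hs₀⟩
  by_contra! h
  obtain ⟨y, hy1, hy2⟩ := exists_between (sub_lt_iff_lt_add.2 h)
  have h1 := key y ((lt_or_ge y 0).imp_right fun hy0 =>
    (ENNReal.ofReal_lt_iff_lt_toReal hy0 htop).2 hy2) q hq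
  linarith

/-- If the domain of the subdifferential is bounded, then the points where it has a value in
`[-K, K]` lie in a compact interval contained in that domain. -/
lemma IsConvexPart.exists_Icc_subset_subdiffDomain {βhat : ℝ → ℝ≥0∞} (hβ : IsConvexPart βhat)
    {r₁ r₂ : ℝ} (hD : subdiffDomain βhat = Ioo r₁ r₂) {K : ℝ} (hK : 0 ≤ K) :
    ∃ a b, a ≤ b ∧ Icc a b ⊆ subdiffDomain βhat ∧
      ∀ r s, s ∈ subdiff βhat r → |s| ≤ K → r ∈ Icc a b := by
  set R := {r | ∃ s ∈ subdiff βhat r, |s| ≤ K} with hR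
  have hRD : R ⊆ Ioo r₁ r₂ := by
    rintro r ⟨s, hs, -⟩
    rw [← hD]
    exact ⟨s, hs⟩
  have h0 : (0 : ℝ) ∈ R := ⟨0, hβ.zero_mem_subdiff, by simpa using hK⟩
  have hcl := hβ.isClosed_setOf_mem_subdiff_abs_le K
  have hbb : BddBelow R := bddBelow_Ioo.mono hRD
  have hba : BddAbove R := bddAbove_Ioo.mono hRD
  refine ⟨sInf R, sSup R, (csInf_le hbb h0).trans (le_csSup hba h0), ?_, fun r s hs hsK =>
    ⟨csInf_le hbb ⟨s, hs, hsK⟩, le_csSup hba ⟨s, hs, hsK⟩⟩⟩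
  rw [hD]
  exact Icc_subset_Ioo (hRD (hcl.csInf_mem ⟨0, h0⟩ hbb)).1 (hRD (hcl.csSup_mem ⟨0, h0⟩ hba)).2

/-! ### Space-time functions -/

lemma cylMeasure_eq_prod {d : ℕ} (Ω : Set (Space d)) (T : ℝ) :
    cylMeasure Ω T = (volume.restrict Ω).prod (timeMeasure T) := by
  rw [cylMeasure, Measure.volume_eq_prod, Measure.prod_restrict]

lemma ae_ae_of_ae_cylMeasure {d : ℕ} {Ω : Set (Space d)} {T : ℝ} {P : Space d × ℝ → Prop}
    (h : ∀ᵐ p ∂cylMeasure Ω T, P p) :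
    ∀ᵐ t ∂timeMeasure T, ∀ᵐ x ∂volume.restrict Ω, P (x, t) := by
  rw [cylMeasure_eq_prod] at h
  exact Measure.ae_ae_of_ae_prod (Measure.measurePreserving_swap.quasiMeasurePreserving.ae h)

lemma ae_cylMeasure_abs_le {d : ℕ} {Ω : Set (Space d)} {T : ℝ} {ξ : Space d × ℝ → ℝ}
    (hξ : AEStronglyMeasurable ξ (cylMeasure Ω T)) {C : ℝ}
    (h : ∀ᵐ t ∂timeMeasure T, ∀ᵐ x ∂volume.restrict Ω, |ξ (x, t)| ≤ C) :
    ∀ᵐ p ∂cylMeasure Ω T, |ξ p| ≤ C := by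
  obtain ⟨ξ', hξ', hae⟩ := hξ
  have hm : MeasurableSet {p | |ξ' p| ≤ C} := measurableSet_le hξ'.measurable.abs measurable_const
  have h1 : ∀ᵐ p ∂cylMeasure Ω T, |ξ' p| ≤ C := by
    rw [cylMeasure_eq_prod, Measure.ae_prod_iff_ae_ae hm, Measure.ae_ae_comm hm]
    filter_upwards [h, ae_ae_of_ae_cylMeasure hae] with t ht ht'
    filter_upwards [ht, ht'] with x hx hx'
    rwa [← hx']
  filter_upwards [h1, hae] with p hp hp'
  rwa [hp']

lemma ae_abs_le_toReal_eLpNorm_top {α : Type*} [MeasurableSpace α] {m : Measure α} {f : α → ℝ}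
    (hf : MemLp f ⊤ m) : ∀ᵐ x ∂m, |f x| ≤ (eLpNorm f ⊤ m).toReal := by
  have h := ae_le_eLpNormEssSup (f := f) (μ := m)
  filter_upwards [h] with x hx
  rw [← eLpNorm_exponent_top] at hx
  simpa using ENNReal.toReal_mono hf.eLpNorm_ne_top hx

lemma IsSmoothPart.exists_abs_deriv_le {πhat : ℝ → ℝ} (hπ : IsSmoothPart πhat) :
    ∃ L, 0 ≤ L ∧ ∀ r, |deriv πhat r| ≤ |deriv πhat 0| + L * |r| := by
  obtain ⟨L, hL⟩ := hπ.lipschitz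
  refine ⟨L, L.2, fun r => ?_⟩
  have h1 := hL.dist_le_mul r 0
  rw [Real.dist_eq, Real.dist_eq, sub_zero] at h1
  have h2 := abs_sub_abs_le_abs_sub (deriv πhat r) (deriv πhat 0)
  linarith

/-- At almost every time, the second equation of the system is the inclusion
`φ - Δφ + ξ = φ + μ - π(φ)`, `ξ ∈ β(φ)`, whose right-hand side bounds `ξ`. -/
lemma IsSolution.ae_abs_le {d : ℕ} {Ω : Set (Space d)} {T : ℝ} {βhat : ℝ → ℝ≥0∞} {πhat : ℝ → ℝ}
    {u : Space d × ℝ → ℝ} {φ₀ : Space d → ℝ} {φ μ ξ : Space d × ℝ → ℝ}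
    (h : IsSolution Ω T βhat πhat u φ₀ φ μ ξ) (hβ : IsConvexPart βhat) (hΩ : IsOpen Ω)
    (hfin : volume Ω ≠ ⊤) (hπ : IsSmoothPart πhat) {C : ℝ} (hC : 0 ≤ C)
    (hg : ∀ᵐ p ∂cylMeasure Ω T, |φ p + μ p - deriv πhat (φ p)| ≤ C) :
    ∀ᵐ p ∂cylMeasure Ω T, |ξ p| ≤ C := by
  obtain ⟨Φ, dφ, N, Ξ, ⟨-, hφ⟩, ⟨-, hμ⟩, ⟨hξm, hξ⟩, -, -, -, -, -, hmem, -, heq, -⟩ := h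
  have hfinite : IsFiniteMeasure (volume.restrict Ω) := ⟨by simpa using hfin.lt_top⟩
  obtain ⟨L, -, hL⟩ := hπ.exists_abs_deriv_le
  have hπc : Continuous (deriv πhat) := hπ.contDiff.continuous_deriv_one
  refine ae_cylMeasure_abs_le hξm ?_
  filter_upwards [hφ, hμ, hξ, ae_ae_of_ae_cylMeasure hmem, ae_ae_of_ae_cylMeasure hg, heq]
    with t hφt hμt hξt hmt hgt heqt
  have hπΦ : MemLp (fun x => deriv πhat ((Φ t).val x)) 2 (volume.restrict Ω) := by
    refine ((memLp_const |deriv πhat 0|).add ((Φ t).memLp_val.abs.const_mul L)).mono'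
      (hπc.comp_aestronglyMeasurable (Φ t).memLp_val.aestronglyMeasurable)
      (Eventually.of_forall fun x => hL _)
  have hΞ : MemLp (Ξ t) 2 (volume.restrict Ω) := Lp.memLp _
  have hF : MemLp (fun x => ((Φ t).val x + (N t).val x - deriv πhat ((Φ t).val x))
      - (Φ t).val x - Ξ t x) 2 (volume.restrict Ω) := by
    refine (((N t).memLp_val.sub hπΦ).sub hΞ).ae_eq (Eventually.of_forall fun x => ?_)
    simp only [Pi.sub_apply]
    ring
  have hmain := ae_abs_le_of_monotone_inclusion hΩ hfin hβ.zero_mem_subdiff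
    le_of_mem_subdiff_of_lt (z := Φ t) (ξ := Ξ t) hF (fun v => ?_) ?_ hC ?_
  · filter_upwards [hmain, hξt] with x hx hx'
    rwa [hx']
  · have e := heqt v
    have e1 : ∫ x in Ω, μ (x, t) * v.val x = ∫ x in Ω, (N t).val x * v.val x :=
      integral_congr_ae (by filter_upwards [hμt] with x hx; rw [hx])
    have e2 : ∫ x in Ω, ξ (x, t) * v.val x = ∫ x in Ω, Ξ t x * v.val x :=
      integral_congr_ae (by filter_upwards [hξt] with x hx; rw [hx])
    have e3 : ∫ x in Ω, deriv πhat (φ (x, t)) * v.val x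
        = ∫ x in Ω, deriv πhat ((Φ t).val x) * v.val x :=
      integral_congr_ae (by filter_upwards [hφt] with x hx; rw [hx])
    have i1 : Integrable (fun x => (N t).val x * v.val x) (volume.restrict Ω) :=
      (N t).memLp_val.integrable_mul v.memLp_val
    have i2 : Integrable (fun x => Ξ t x * v.val x) (volume.restrict Ω) :=
      hΞ.integrable_mul v.memLp_val
    have i3 : Integrable (fun x => deriv πhat ((Φ t).val x) * v.val x) (volume.restrict Ω) :=
      hπΦ.integrable_mul v.memLp_val
    have e4 : ∫ x in Ω, ((Φ t).val x + (N t).val x - deriv πhat ((Φ t).val x)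
        - (Φ t).val x - Ξ t x) * v.val x
        = (∫ x in Ω, (N t).val x * v.val x) - (∫ x in Ω, Ξ t x * v.val x)
          - ∫ x in Ω, deriv πhat ((Φ t).val x) * v.val x := by
      have i4 : Integrable (fun x => (N t).val x * v.val x - Ξ t x * v.val x)
        (volume.restrict Ω) := i1.sub i2
      rw [← integral_sub i1 i2, ← integral_sub i4 i3]
      refine integral_congr_ae (Eventually.of_forall fun x => ?_)
      simp only
      ring
    rw [e1, e2, e3] at e
    rw [e4]
    linarith
  · filter_upwards [hmt, hφt, hξt] with x h1 h2 h3
    rwa [← h2, ← h3]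
  · filter_upwards [hgt, hφt, hμt] with x h1 h2 h3
    rwa [← h2, ← h3]

end CahnHilliardOono

open CahnHilliardOono
theorem proposition2p5 (βhat : ℝ → ℝ≥0∞) (hβ : IsConvexPart βhat) :
    -- boundedness of `φ` and `μ` implies boundedness of `ξ`, with the estimate
    (∀ (πhat : ℝ → ℝ) (d : ℕ) (Ω : Set (Space d)) (T : ℝ)
      (u : Space d × ℝ → ℝ) (M : ℝ) (φ₀ : Space d → ℝ) (φ μ ξ : Space d × ℝ → ℝ),
      Assumptions Ω T βhat πhat u M φ₀ →
      IsSolution Ω T βhat πhat u φ₀ φ μ ξ →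
      MemLp φ ⊤ (cylMeasure Ω T) → MemLp μ ⊤ (cylMeasure Ω T) →
        MemLp ξ ⊤ (cylMeasure Ω T) ∧
        eLpNorm ξ ⊤ (cylMeasure Ω T)
          ≤ eLpNorm (fun p => φ p + μ p - deriv πhat (φ p)) ⊤ (cylMeasure Ω T)) ∧
    -- separation: the compact interval depends only on `β` and on the bound `K` for `‖ξ‖_∞`
    ((∃ r₁ r₂ : ℝ, subdiffDomain βhat = Ioo r₁ r₂) →
      ∀ K : ℝ, ∃ a b : ℝ, a ≤ b ∧ Icc a b ⊆ subdiffDomain βhat ∧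
        ∀ (πhat : ℝ → ℝ) (d : ℕ) (Ω : Set (Space d)) (T : ℝ)
          (u : Space d × ℝ → ℝ) (M : ℝ) (φ₀ : Space d → ℝ) (φ μ ξ : Space d × ℝ → ℝ),
          Assumptions Ω T βhat πhat u M φ₀ →
          IsSolution Ω T βhat πhat u φ₀ φ μ ξ →
          eLpNorm ξ ⊤ (cylMeasure Ω T) ≤ ENNReal.ofReal K →
            ∀ᵐ p ∂cylMeasure Ω T, φ p ∈ Icc a b) := by
  constructor
  · intro πhat d Ω T u M φ₀ φ μ ξ hA hsol hφ hμ
    obtain ⟨L, hL0, hL⟩ := hA.smoothPart.exists_abs_deriv_le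
    have hπφ : MemLp (fun p => deriv πhat (φ p)) ⊤ (cylMeasure Ω T) := by
      refine memLp_top_of_bound (hA.smoothPart.contDiff.continuous_deriv_one.comp_aestronglyMeasurable
        hφ.aestronglyMeasurable) (|deriv πhat 0| + L * (eLpNorm φ ⊤ (cylMeasure Ω T)).toReal) ?_
      filter_upwards [ae_abs_le_toReal_eLpNorm_top hφ] with p hp
      refine (hL _).trans ?_
      gcongr
    have hg : MemLp (fun p => φ p + μ p - deriv πhat (φ p)) ⊤ (cylMeasure Ω T) :=
      (hφ.add hμ).sub hπφ
    have hb := hsol.ae_abs_le hβ hA.domain.isOpen hA.domain.isBounded.measure_lt_top.ne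
      hA.smoothPart ENNReal.toReal_nonneg (ae_abs_le_toReal_eLpNorm_top hg)
    have hξm : AEStronglyMeasurable ξ (cylMeasure Ω T) := by
      obtain ⟨_, _, _, _, _, _, hξ, _⟩ := hsol
      exact hξ.1
    refine ⟨memLp_top_of_bound hξm _ hb, ?_⟩
    rw [← ENNReal.ofReal_toReal hg.eLpNorm_ne_top, eLpNorm_exponent_top]
    exact eLpNormEssSup_le_of_ae_bound hb
  · rintro ⟨r₁, r₂, hD⟩ K
    -- For `K < 0` the bound on `ξ` reads `‖ξ‖_∞ ≤ 0`, because `ENNReal.ofReal K = 0`.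
    obtain ⟨a, b, hab, hsub, hI⟩ := hβ.exists_Icc_subset_subdiffDomain hD (le_max_right K 0)
    refine ⟨a, b, hab, hsub, fun πhat d Ω T u M φ₀ φ μ ξ _ hsol hK => ?_⟩
    obtain ⟨_, _, _, _, _, _, hξ, _, _, _, _, _, hmem, _⟩ := hsol
    have hξL : MemLp ξ ⊤ (cylMeasure Ω T) := ⟨hξ.1, hK.trans_lt ENNReal.ofReal_lt_top⟩
    filter_upwards [hmem, ae_abs_le_toReal_eLpNorm_top hξL] with p hp hp'
    refine hI _ _ hp (hp'.trans ?_)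
    rw [← ENNReal.toReal_ofReal']
    exact ENNReal.toReal_mono ENNReal.ofReal_ne_top hK
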